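/- **Definitions.** An *operator space* is a complex Banach space $\mathcal S$ with norms $\|\cdot\|_n$ on $M_n(\mathcal S)$, $n\ge 1$ (with $\|\cdot\|_1$ the given norm), satisfying Ruan's axioms $\|x\oplus y\|_{m+n}=\max\{\|x\|_m,\|y\|_n\}$ and $\|\alpha x\beta\|_n\le\|\alpha\|\,\|x\|_n\,\|\beta\|$ for $\alpha,\beta\in M_n(\mathbb C)$. $\mathbf{OpSp}$ is the category of operator spaces and completely contractive linear maps; $\mathbf{C^*}$ is the category of unital $C^*$-algebras (the zero algebra included) and unital $*$-homomorphisms. A *$C^*$-graph* is a pair $(\mathcal A,\mathcal S)$ of a unital $C^*$-algebra $\mathcal A$ and an operator space $\mathcal S$ that is a unital $\mathcal A$-bimodule (compatibly with the complex scalars) with $\|a\cdot x\cdot c\|\le\|a\|\,\|x\|\,\|c\|$ for all $a,c\in\mathcal A$, $x\in\mathcal S$. A *morphism* from $(\mathcal A_2,\mathcal S_2)$ to $(\mathcal A_1,\mathcal S_1)$ is a pair $(\pi,e)$ of a unital $*$-homomorphism $\pi:\mathcal A_1\to\mathcal A_2$ and a completely contractive linear map $e:\mathcal S_2\to\mathcal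 S_1$ with $$a_1\cdot e(s)\cdot a_2=e(\pi(a_1)\cdot s\cdot\pi(a_2))\qquad(a_1,a_2\in\mathcal A_1,\ s\in\mathcal S_2).$$ The bimodule $\mathcal S$ is an *operator $\mathcal A$-bimodule* if there are Hilbert spaces $H,K$, a complete isometry $\iota:\mathcal S\to B(H,K)$ and a completely contractive homomorphism $\rho:\mathcal A\to B(K)$ with $\iota(a\cdot x)=\rho(a)\iota(x)$, and likewise (with possibly different $H,K,\iota$) a completely contractive homomorphism $\rho':\mathcal A\to B(H)$ with $\iota(x\cdot a)=\iota(x)\rho'(a)$. **Theorem.** Let $J$ be a nonempty directed set and let $((\mathcal A_j,\mathcal S_j),(\pi_{j,k},e^{j,k}))_{j\le k\text{ in }J}$ be a projective system of $C^*$-graphs, with $\pi_{j,k}:\mathcal A_j\to\mathcal A_k$ and $e^{j,k}:\mathcal S_k\to\mathcal S_j$. Then the inductive limit $(\mathcal A,\pi_{j,\infty})$ of the $\mathcal A_j$ in $\mathbf{C^*}$ and the projective limit $(\mathcal S,e^{j,\infty})$ of the $\mathcal S_j$ in $\mathbf{OpSp}$ exist, and for any choice of these two limits: 1. there is exactly one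 $C^*$-graph structure on $(\mathcal A,\mathcal S)$, i.e. one contractive $\mathcal A$-bimodule structure on $\mathcal S$, for which every $(\pi_{j,\infty},e^{j,\infty})$ is a morphism from $(\mathcal A,\mathcal S)$ to $(\mathcal A_j,\mathcal S_j)$; 2. with this structure, $(\mathcal A,\mathcal S)$ with the morphisms $(\pi_{j,\infty},e^{j,\infty})$ is the projective limit of the system in the category of $C^*$-graphs; 3. for all $i,j\le k$, $a\in\mathcal A_i$ and $x\in\mathcal S$, $$e^{j,\infty}(\pi_{i,\infty}(a)\cdot x)=e^{j,k}\big(\pi_{i,k}(a)\cdot e^{k,\infty}(x)\big),\qquad e^{j,\infty}(x\cdot\pi_{i,\infty}(a))=e^{j,k}\big(e^{k,\infty}(x)\cdot\pi_{i,k}(a)\big);$$ 4. if every $\mathcal S_j$ is an operator $\mathcal A_j$-bimodule, then $\mathcal S$ is an operator $\mathcal A$-bimodule (so that $(\mathcal A,\mathcal S)$ is then also the projective limit in the full subcategory of $C^*$-graphs whose bimodules are operator bimodules). -/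

import Mathlib

open CategoryTheory CategoryTheory.Limits Opposite

universe u

noncomputable section

/-- An abstract operator space: a complex Banach space `X` with norms on all the matrix spaces
`M_n(X)` which satisfy Ruan's axioms; the norm on `M_1(X) = X` is the given one. -/
class OperatorSpace (X : Type u) extends NormedAddCommGroup X, NormedSpace ℂ X,
    CompleteSpace X where
  matNorm : ∀ n : ℕ, Seminorm ℂ (Matrix (Fin n) (Fin n) X)
  eq_zero_of_matNorm : ∀ (n : ℕ) (x : Matrix (Fin n) (Fin n) X), matNorm n x = 0 → x = 0
  matNorm_one : ∀ x : Matrix (Fin 1) (Fin 1) X, matNorm 1 x = ‖x 0 0‖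
  /-- `‖x ⊕ y‖ = max ‖x‖ ‖y‖`. -/
  matNorm_sum : ∀ (m n : ℕ) (x : Matrix (Fin m) (Fin m) X) (y : Matrix (Fin n) (Fin n) X),
    matNorm (m + n) (Matrix.reindex finSumFinEquiv finSumFinEquiv (Matrix.fromBlocks x 0 0 y))
      = max (matNorm m x) (matNorm n y)
  /-- `‖α x β‖ ≤ ‖α‖ ‖x‖ ‖β‖` for scalar matrices `α`, `β` with their operator norms. -/
  matNorm_mul_le : ∀ (n : ℕ) (α β : Matrix (Fin n) (Fin n) ℂ) (x : Matrix (Fin n) (Fin n) X),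
    matNorm n (Matrix.of fun i j => ∑ k, ∑ l, (α i k * β l j) • x k l)
      ≤ ‖Matrix.toEuclideanCLM (𝕜 := ℂ) α‖ * matNorm n x * ‖Matrix.toEuclideanCLM (𝕜 := ℂ) β‖

/-- The objects of the category of operator spaces. -/
structure OpSp : Type (u + 1) where
  carrier : Type u
  [str : OperatorSpace carrier]

attribute [instance] OpSp.str

instance : CoeSort OpSp.{u} (Type u) := ⟨OpSp.carrier⟩

/-- Completely contractive linear maps. -/
@[ext]
structure OpSp.Hom (X Y : OpSp.{u}) : Type u where
  lin : X →ₗ[ℂ] Y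
  contr : ∀ (n : ℕ) (x : Matrix (Fin n) (Fin n) X),
    OperatorSpace.matNorm n (x.map lin) ≤ OperatorSpace.matNorm n x

/-- The category of operator spaces and completely contractive maps. -/
instance : Category OpSp.{u} where
  Hom := OpSp.Hom
  id X := ⟨LinearMap.id, fun _ _ => le_of_eq rfl⟩
  comp f g := ⟨g.lin ∘ₗ f.lin, fun n x => (g.contr n (x.map f.lin)).trans (f.contr n x)⟩

/-- The objects of the category of unital C⋆-algebras (the zero algebra is allowed). -/
structure UnitalCStarAlg : Type (u + 1) where
  carrier : Type u
  [str : CStarAlgebra carrier]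

attribute [instance] UnitalCStarAlg.str

instance : CoeSort UnitalCStarAlg.{u} (Type u) := ⟨UnitalCStarAlg.carrier⟩

/-- Unital ⋆-homomorphisms. -/
@[ext]
structure UnitalCStarAlg.Hom (A B : UnitalCStarAlg.{u}) : Type u where
  hom : A →⋆ₐ[ℂ] B

/-- The category of unital C⋆-algebras and unital ⋆-homomorphisms. -/
instance : Category UnitalCStarAlg.{u} where
  Hom := UnitalCStarAlg.Hom
  id A := ⟨StarAlgHom.id ℂ A⟩
  comp f g := ⟨g.hom.comp f.hom⟩

/-- A (unital) contractive `A`-bimodule structure on the operator space `S`: commuting left and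
right actions, compatible with the complex vector space structures, with
`‖a · x · c‖ ≤ ‖a‖ ‖x‖ ‖c‖`. The right action is a left action of the opposite algebra. -/
@[ext]
structure ContractiveBimodule (A : Type u) [CStarAlgebra A] (S : Type u) [OperatorSpace S] :
    Type u where
  left : A →ₐ[ℂ] Module.End ℂ S
  right : Aᵐᵒᵖ →ₐ[ℂ] Module.End ℂ S
  comm : ∀ (a c : A) (x : S),
    left a (right (MulOpposite.op c) x) = right (MulOpposite.op c) (left a x)
  norm_le : ∀ (a c : A) (x : S), ‖left a (right (MulOpposite.op c) x)‖ ≤ ‖a‖ * ‖x‖ * ‖c‖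

/-- The element `a · x · c`. -/
def ContractiveBimodule.act {A S : Type u} [CStarAlgebra A] [OperatorSpace S]
    (b : ContractiveBimodule A S) (a : A) (x : S) (c : A) : S :=
  b.left a (b.right (MulOpposite.op c) x)

/-- The norm of a matrix of operators `H → K`, as an operator from the Hilbert space `Hⁿ` to
the Hilbert space `Kⁿ`. -/
def opMatNorm {H K : Type u} [NormedAddCommGroup H] [InnerProductSpace ℂ H]
    [NormedAddCommGroup K] [InnerProductSpace ℂ K] {n : ℕ}
    (T : Matrix (Fin n) (Fin n) (H →L[ℂ] K)) : ℝ :=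
  ‖((PiLp.continuousLinearEquiv 2 ℂ (fun _ : Fin n => K)).symm.toContinuousLinearMap ∘L
      (ContinuousLinearMap.pi fun i => ∑ j, T i j ∘L PiLp.proj 2 (fun _ : Fin n => H) j) :
    PiLp 2 (fun _ : Fin n => H) →L[ℂ] PiLp 2 (fun _ : Fin n => K))‖

/-- The C⋆-norm on the matrices over a unital C⋆-algebra. -/
def cstarMatNorm {A : Type u} [CStarAlgebra A] {n : ℕ} (a : Matrix (Fin n) (Fin n) A) : ℝ :=
  letI : PartialOrder A := CStarAlgebra.spectralOrder A
  haveI : StarOrderedRing A := CStarAlgebra.spectralOrderedRing A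
  ‖CStarMatrix.ofMatrix a‖

/-- `ι : S → B(H, K)` is a complete isometry. -/
def IsCompleteIsometry {S H K : Type u} [OperatorSpace S] [NormedAddCommGroup H]
    [InnerProductSpace ℂ H] [NormedAddCommGroup K] [InnerProductSpace ℂ K]
    (ι : S →ₗ[ℂ] (H →L[ℂ] K)) : Prop :=
  ∀ (n : ℕ) (x : Matrix (Fin n) (Fin n) S), opMatNorm (x.map ι) = OperatorSpace.matNorm n x

/-- `ρ : A → B(H)` is completely contractive. -/
def IsCompletelyContractiveRep {A H : Type u} [CStarAlgebra A] [NormedAddCommGroup H]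
    [InnerProductSpace ℂ H] (ρ : A →ₙₐ[ℂ] (H →L[ℂ] H)) : Prop :=
  ∀ (n : ℕ) (a : Matrix (Fin n) (Fin n) A), opMatNorm (a.map ρ) ≤ cstarMatNorm a

/-- An operator `A`-bimodule: both the left and the right action are implemented on Hilbert spaces,
by a complete isometry `S → B(H, K)` and a completely contractive homomorphism from `A` to `B(K)`
(left action), respectively to `B(H)` (right action). -/
def ContractiveBimodule.IsOperatorBimodule {A S : Type u} [CStarAlgebra A] [OperatorSpace S]
    (b : ContractiveBimodule A S) : Prop :=
  (∃ (H K : Type u) (_ : NormedAddCommGroup H) (_ : InnerProductSpace ℂ H) (_ : CompleteSpace H)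
      (_ : NormedAddCommGroup K) (_ : InnerProductSpace ℂ K) (_ : CompleteSpace K)
      (ι : S →ₗ[ℂ] (H →L[ℂ] K)) (ρ : A →ₙₐ[ℂ] (K →L[ℂ] K)),
    IsCompleteIsometry ι ∧ IsCompletelyContractiveRep ρ ∧
      ∀ (a : A) (x : S), ι (b.left a x) = ρ a ∘L ι x) ∧
  (∃ (H K : Type u) (_ : NormedAddCommGroup H) (_ : InnerProductSpace ℂ H) (_ : CompleteSpace H)
      (_ : NormedAddCommGroup K) (_ : InnerProductSpace ℂ K) (_ : CompleteSpace K)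
      (ι : S →ₗ[ℂ] (H →L[ℂ] K)) (ρ : A →ₙₐ[ℂ] (H →L[ℂ] H)),
    IsCompleteIsometry ι ∧ IsCompletelyContractiveRep ρ ∧
      ∀ (a : A) (x : S), ι (b.right (MulOpposite.op a) x) = ι x ∘L ρ a)

/-- A C⋆-graph: a unital C⋆-algebra with an operator space which is a bimodule over it. -/
structure CStarGraph : Type (u + 1) where
  alg : UnitalCStarAlg.{u}
  space : OpSp.{u}
  bimod : ContractiveBimodule alg space

/-- A morphism of C⋆-graphs from `G` to `G'`: a complete contraction `e` from the space of `G`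
to that of `G'` and a unital ⋆-homomorphism `π` from the algebra of `G'` to that of `G`, with
`a · e x · c = e (π a · x · π c)`. -/
@[ext]
structure CStarGraph.Hom (G G' : CStarGraph.{u}) : Type u where
  π : G'.alg ⟶ G.alg
  e : G.space ⟶ G'.space
  act_eq : ∀ (a c : G'.alg) (x : G.space),
    G'.bimod.act a (e.lin x) c = e.lin (G.bimod.act (π.hom a) x (π.hom c))

/-- The category of C⋆-graphs. -/
instance : Category CStarGraph.{u} where
  Hom := CStarGraph.Hom
  id G := ⟨𝟙 G.alg, 𝟙 G.space, fun _ _ _ => rfl⟩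
  comp f g := ⟨g.π ≫ f.π, f.e ≫ g.e, fun a c x =>
    (g.act_eq a c (f.e.lin x)).trans
      (congrArg g.e.lin (f.act_eq (g.π.hom a) (g.π.hom c) x))⟩

namespace CStarGraph

/-- `(A, S) ↦ A`, contravariant. -/
def algFunctor : CStarGraph.{u} ⥤ UnitalCStarAlg.{u}ᵒᵖ where
  obj G := op G.alg
  map f := Quiver.Hom.op f.π

/-- `(A, S) ↦ S`. -/
def spaceFunctor : CStarGraph.{u} ⥤ OpSp.{u} where
  obj G := G.space
  map f := f.e

variable {J : Type u} [Preorder J]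

/-- The inductive system `(A_j, π_{j,k})` of C⋆-algebras of a projective system of C⋆-graphs. -/
abbrev algSystem (F : Jᵒᵖ ⥤ CStarGraph.{u}) : J ⥤ UnitalCStarAlg.{u} :=
  (F ⋙ algFunctor).unop

/-- The projective system `(S_j, e^{j,k})` of operator spaces of a projective system of
C⋆-graphs. -/
abbrev spaceSystem (F : Jᵒᵖ ⥤ CStarGraph.{u}) : Jᵒᵖ ⥤ OpSp.{u} :=
  F ⋙ spaceFunctor

/-- The pairs `(π_{j,∞}, e^{j,∞})` satisfy `a · e x · c = e (π a · x · π c)` for the bimodule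
structure `b`. -/
def IsCompatible (F : Jᵒᵖ ⥤ CStarGraph.{u}) (A : Cocone (algSystem F)) (S : Cone (spaceSystem F))
    (b : ContractiveBimodule A.pt S.pt) : Prop :=
  ∀ (j : J) (a c : (F.obj (op j)).alg) (x : S.pt),
    (F.obj (op j)).bimod.act a ((S.π.app (op j)).lin x) c =
      (S.π.app (op j)).lin (b.act ((A.ι.app j).hom a) x ((A.ι.app j).hom c))

/-- The cone over a projective system of C⋆-graphs with vertex `(A, S)` and legs
`(π_{j,∞}, e^{j,∞})`. -/
def pairCone (F : Jᵒᵖ ⥤ CStarGraph.{u}) (A : Cocone (algSystem F)) (S : Cone (spaceSystem F))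
    (b : ContractiveBimodule A.pt S.pt) (h : IsCompatible F A S b) : Cone F where
  pt := ⟨A.pt, S.pt, b⟩
  π :=
    { app := fun j => ⟨A.ι.app j.unop, S.π.app j, h j.unop⟩
      naturality := fun _ _ f =>
        CStarGraph.Hom.ext (A.w f.unop).symm (S.w f).symm }

end CStarGraph

end

/-! Both limits have concrete models that can be described without universal properties. The
inductive limit of the algebras is the completion of the eventually coherent families for the
C⋆-seminorm `lim ‖a_j‖`. What matters about it is recorded in `IsDirectedLimit`: the stages have
jointly dense image, and the norm of a stage element in the limit is the infimum of its norms at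
later stages. The projective limit of the spaces consists of the norm-bounded coherent families with
the suprema of the matrix norms (`IsProjectiveLimit`). Both descriptions are invariant under
isomorphism, so they hold for every choice of limits.

An element of `A_i` acts on a coherent family componentwise at all stages above `i`; these
components determine the others. The action is bounded by `‖a‖`, is compatible with the transition
maps, and therefore extends by density to the limit algebra (`exists_limit_action`). The bimodule
identities, uniqueness and the equivariance of mediating maps are closed conditions on the algebra
variables, so they need checking only on stage elements, pushed to a common stage.

For operator bimodules, a direct sum of the given representations would embed the limit space, but
an element of `A_i` acts only on the summands above `i`. An ultraproduct along an ultrafilter finer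
than `atTop` ignores all other indices. It preserves the matrix norms of the limit space because
these are monotone limits of stage norms. Complete contractivity of the limit representation needs
the infimum formula for matrix norms over the algebras, `exists_cstarMatNorm_lt`; it follows from
the entrywise formula by taking high powers of `a⋆a`. -/

noncomputable section

open Filter Topology UniformSpace

/-! ### Completions of seminormed structures -/

/-- The Hausdorff completion of a complex ⋆-algebra with respect to a C⋆-seminorm is a
C⋆-algebra. -/
theorem exists_cstarAlgebra_of_ringSeminorm (D : Type u) [Ring D] [StarRing D] [Algebra ℂ D]
    [StarModule ℂ D] (p : RingSeminorm D) (hsmul : ∀ (c : ℂ) (x : D), p (c • x) = ‖c‖ * p x)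
    (hstar : ∀ x, p (star x * x) = p x * p x) :
    ∃ (A : Type u) (_ : CStarAlgebra A) (q : D →⋆ₐ[ℂ] A), DenseRange q ∧ ∀ d, ‖q d‖ = p d := by
  let : SeminormedRing D := p.toSeminormedRing
  let : NormedAlgebra ℂ D := ⟨fun c x => (hsmul c x).le⟩
  -- The C⋆-identity and submultiplicativity give `‖x‖² ≤ ‖x⋆‖ ‖x‖`; cancelling `‖x‖` when it is
  -- nonzero makes the involution isometric, so it extends to the completion.
  have hle : ∀ x : D, ‖x‖ ≤ ‖star x‖ := by
    intro x
    rcases (norm_nonneg x).eq_or_lt with h | h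
    · rw [← h]; exact norm_nonneg _
    · refine le_of_mul_le_mul_right ?_ h
      exact (hstar x).symm.le.trans (norm_mul_le (star x) x)
  have : NormedStarGroup D := ⟨fun x => by simpa using hle (star x)⟩
  have huc : UniformContinuous (star : D → D) :=
    (starₗᵢ ℂ : D ≃ₗᵢ⋆[ℂ] D).isometry.uniformContinuous
  let : Star (Completion D) := ⟨Completion.map star⟩
  have hcoe : ∀ x : D, star (x : Completion D) = ((star x : D) : Completion D) := fun x =>
    Completion.map_coe huc x
  have hcont : Continuous (star : Completion D → Completion D) := Completion.continuous_map
  let : StarRing (Completion D) :=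
    { star_involutive := fun x => by
        induction x using Completion.induction_on with
        | hp => exact isClosed_eq (hcont.comp hcont) continuous_id
        | ih x => simp [hcoe]
      star_mul := fun x y => by
        induction x, y using Completion.induction_on₂ with
        | hp => exact isClosed_eq (by fun_prop) (by fun_prop)
        | ih x y => simp [hcoe, ← Completion.coe_mul]
      star_add := fun x y => by
        induction x, y using Completion.induction_on₂ with
        | hp => exact isClosed_eq (by fun_prop) (by fun_prop)
        | ih x y => simp [hcoe, ← Completion.coe_add] }
  let : NormedAlgebra ℂ (Completion D) :=
    { norm_smul_le := norm_smul_le }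
  let : CStarAlgebra (Completion D) :=
    { norm_mul_self_le := fun x => by
        induction x using Completion.induction_on with
        | hp => exact isClosed_le (by fun_prop) (by fun_prop)
        | ih x =>
          rw [hcoe, ← Completion.coe_mul, Completion.norm_coe, Completion.norm_coe]
          exact (hstar x).symm.le
      star_smul := fun c x => by
        induction x using Completion.induction_on with
        | hp =>
          exact isClosed_eq (hcont.comp (continuous_const_smul c)) (hcont.const_smul (star c))
        | ih x =>
          rw [← Completion.coe_smul, hcoe, hcoe, ← Completion.coe_smul]
          exact congrArg _ (star_smul c x) }
  refine ⟨Completion D, inferInstance,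
    { toFun := fun d => (d : Completion D)
      map_one' := Completion.coe_one D
      map_mul' := Completion.coe_mul
      map_zero' := Completion.coe_zero
      map_add' := Completion.coe_add
      commutes' := fun c => rfl
      map_star' := fun x => (hcoe x).symm }, Completion.denseRange_coe,
    fun d => Completion.norm_coe d⟩

/-- The Hausdorff completion of a complex vector space with respect to a seminorm which satisfies
the parallelogram law is a Hilbert space. -/
theorem exists_hilbert_of_seminorm (E : Type u) [AddCommGroup E] [Module ℂ E] (p : Seminorm ℂ E)
    (hp : ∀ x y, p (x + y) * p (x + y) + p (x - y) * p (x - y) = 2 * (p x * p x + p y * p y)) :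
    ∃ (K : Type u) (_ : NormedAddCommGroup K) (_ : InnerProductSpace ℂ K) (_ : CompleteSpace K)
      (q : E →ₗ[ℂ] K), DenseRange q ∧ ∀ x, ‖q x‖ = p x := by
  let : SeminormedAddCommGroup E := p.toSeminormedAddCommGroup
  let : NormedSpace ℂ E := ⟨fun c x => (map_smul_eq_mul p c x).le⟩
  have h : ∀ x y : Completion E,
      ‖x + y‖ * ‖x + y‖ + ‖x - y‖ * ‖x - y‖ = 2 * (‖x‖ * ‖x‖ + ‖y‖ * ‖y‖) := fun x y => by
    induction x, y using Completion.induction_on₂ with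
    | hp => exact isClosed_eq (by fun_prop) (by fun_prop)
    | ih x y =>
      rw [← Completion.coe_add, ← Completion.coe_sub]
      simp only [Completion.norm_coe]
      exact hp x y
  -- Jordan–von Neumann: the parallelogram law, inherited by the completion, yields the inner
  -- product.
  exact ⟨Completion E, inferInstance, InnerProductSpace.ofNorm ℂ h, inferInstance,
    (Completion.toComplₗᵢ (𝕜 := ℂ) (E := E)).toLinearMap, Completion.denseRange_coe,
    fun x => Completion.norm_coe x⟩

/-! ### Inductive limits of C⋆-algebras -/

namespace UnitalCStarAlg

theorem norm_hom_le {A B : UnitalCStarAlg.{u}} (f : A ⟶ B) (a : A) : ‖f.hom a‖ ≤ ‖a‖ :=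
  NonUnitalStarAlgHom.norm_apply_le f.hom a

theorem comp_hom_apply {A B C : UnitalCStarAlg.{u}} (f : A ⟶ B) (g : B ⟶ C) (a : A) :
    (f ≫ g).hom a = g.hom (f.hom a) := rfl

theorem id_hom_apply {A : UnitalCStarAlg.{u}} (a : A) : UnitalCStarAlg.Hom.hom (𝟙 A) a = a := rfl

variable {J : Type u} [Preorder J] (G : J ⥤ UnitalCStarAlg.{u})

theorem map_map {i j k : J} (hij : i ≤ j) (hjk : j ≤ k) (a : G.obj i) :
    (G.map (homOfLE hjk)).hom ((G.map (homOfLE hij)).hom a) =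
      (G.map (homOfLE (hij.trans hjk))).hom a := by
  rw [← comp_hom_apply, ← G.map_comp, homOfLE_comp]

theorem map_refl {i : J} (h : i ≤ i) (a : G.obj i) : (G.map (homOfLE h)).hom a = a := by
  have : homOfLE h = 𝟙 i := rfl
  rw [this, G.map_id, id_hom_apply]

variable {G} in
/-- The leg `π_{i,∞}` of a cocone of C⋆-algebras as a ⋆-homomorphism. -/
def leg (A : Cocone G) (i : J) : G.obj i →⋆ₐ[ℂ] A.pt := (A.ι.app i).hom

variable {G} in
theorem leg_map (A : Cocone G) {i j : J} (h : i ≤ j) (a : G.obj i) :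
    leg A j ((G.map (homOfLE h)).hom a) = leg A i a :=
  congrArg (fun f => UnitalCStarAlg.Hom.hom f a) (A.w (homOfLE h))

variable {G} in
theorem norm_leg_le (A : Cocone G) (i : J) (a : G.obj i) : ‖leg A i a‖ ≤ ‖a‖ :=
  norm_hom_le (A.ι.app i) a

/-- The ⋆-algebra of the eventually coherent families in an inductive system of
C⋆-algebras. -/
def coherent [IsDirectedOrder J] [Nonempty J] : StarSubalgebra ℂ (∀ j, G.obj j) where
  carrier := {a | ∃ i, ∀ j (h : i ≤ j), a j = (G.map (homOfLE h)).hom (a i)}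
  mul_mem' := by
    rintro a b ⟨i, hi⟩ ⟨j, hj⟩
    obtain ⟨k, hik, hjk⟩ := exists_ge_ge i j
    refine ⟨k, fun l h => ?_⟩
    simp only [Pi.mul_apply]
    rw [hi l (hik.trans h), hj l (hjk.trans h), hi k hik, hj k hjk, map_mul, map_map, map_map]
  add_mem' := by
    rintro a b ⟨i, hi⟩ ⟨j, hj⟩
    obtain ⟨k, hik, hjk⟩ := exists_ge_ge i j
    refine ⟨k, fun l h => ?_⟩
    simp only [Pi.add_apply]
    rw [hi l (hik.trans h), hj l (hjk.trans h), hi k hik, hj k hjk, map_add, map_map, map_map]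
  algebraMap_mem' c := ⟨Classical.arbitrary J, fun l h => by
    simp only [Pi.algebraMap_apply]
    exact (AlgHomClass.commutes _ c).symm⟩
  star_mem' := by
    rintro a ⟨i, hi⟩
    refine ⟨i, fun l h => ?_⟩
    simp only [Pi.star_apply]
    rw [hi l h, map_star]

end UnitalCStarAlg

theorem exists_tendsto_of_eventually_antitone {J : Type*} [Preorder J] [IsDirectedOrder J]
    {f : J → ℝ} (hf : ∀ j, 0 ≤ f j) {i : J} (h : ∀ j k, i ≤ j → j ≤ k → f k ≤ f j) :
    ∃ l, Tendsto f atTop (𝓝 l) := by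
  have : Nonempty J := ⟨i⟩
  have hbdd : BddBelow (f '' Set.Ici i) := ⟨0, by rintro _ ⟨j, -, rfl⟩; exact hf j⟩
  refine ⟨sInf (f '' Set.Ici i), tendsto_order.2 ⟨fun c hc => ?_, fun c hc => ?_⟩⟩
  · filter_upwards [eventually_ge_atTop i] with k hk
    exact hc.trans_le (csInf_le hbdd ⟨k, hk, rfl⟩)
  · obtain ⟨_, ⟨j, hj, rfl⟩, hjc⟩ := exists_lt_of_csInf_lt (Set.Nonempty.image f ⟨i, le_refl i⟩) hc
    filter_upwards [eventually_ge_atTop j] with k hk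
    exact (h j k hj hk).trans_lt hjc

namespace UnitalCStarAlg

variable {J : Type u} [Preorder J] {G : J ⥤ UnitalCStarAlg.{u}}

/-- A cocone over an inductive system of C⋆-algebras whose legs have jointly dense range and
satisfy `‖π_{i,∞} a‖ = inf_k ‖π_{i,k} a‖`. -/
structure IsDirectedLimit (A : Cocone G) : Prop where
  dense : DenseRange fun p : Σ j, G.obj j => leg A p.1 p.2
  exists_norm_lt : ∀ (i : J) (a : G.obj i) (c : ℝ), ‖leg A i a‖ < c →
    ∃ (k : J) (h : i ≤ k), ‖(G.map (homOfLE h)).hom a‖ < c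

theorem IsDirectedLimit.induction {A : Cocone G} (hA : IsDirectedLimit A)
    {P : A.pt → Prop} (hc : IsClosed {a | P a})
    (h : ∀ (i : J) (a : G.obj i), P (leg A i a)) (a : A.pt) : P a :=
  hA.dense.induction_on a hc fun p => h p.1 p.2

variable [IsDirectedOrder J] [Nonempty J]

theorem coherent.exists_tendsto_norm (a : coherent G) :
    ∃ l, Tendsto (fun j => ‖a.1 j‖) atTop (𝓝 l) := by
  obtain ⟨i, hi⟩ := a.2
  refine exists_tendsto_of_eventually_antitone (fun _ => norm_nonneg _) (i := i)
    fun j k hij hjk => ?_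
  rw [hi k (hij.trans hjk), hi j hij, ← map_map G hij hjk]
  exact norm_hom_le _ _

/-- The limit of the norms of an eventually coherent family. -/
def coherent.limNorm (a : coherent G) : ℝ := (coherent.exists_tendsto_norm a).choose

theorem coherent.tendsto_norm (a : coherent G) :
    Tendsto (fun j => ‖a.1 j‖) atTop (𝓝 (limNorm a)) :=
  (coherent.exists_tendsto_norm a).choose_spec

/-- The C⋆-seminorm on the eventually coherent families. -/
def coherent.ringSeminorm : RingSeminorm (coherent G) where
  toFun := coherent.limNorm
  map_zero' := tendsto_nhds_unique (tendsto_norm 0) (by simp)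
  add_le' a b := le_of_tendsto_of_tendsto' (tendsto_norm _)
    ((tendsto_norm a).add (tendsto_norm b)) fun _ => norm_add_le _ _
  neg' a := tendsto_nhds_unique (tendsto_norm _) (by simpa using tendsto_norm a)
  mul_le' a b := le_of_tendsto_of_tendsto' (tendsto_norm _)
    ((tendsto_norm a).mul (tendsto_norm b)) fun _ => norm_mul_le _ _

open Classical in
/-- The coherent family which starts at `i` with `a`. -/
def coherent.tail {i : J} (a : G.obj i) : coherent G :=
  ⟨fun j => if h : i ≤ j then (G.map (homOfLE h)).hom a else 0, i, fun j h => by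
    simp only [le_refl, h, dite_true]
    rw [map_refl]⟩

theorem coherent.tail_apply {i j : J} (a : G.obj i) (h : i ≤ j) :
    (coherent.tail a).1 j = (G.map (homOfLE h)).hom a := dif_pos h

variable (G) in
-- ⋆-homomorphisms are contractive, so the norms along a coherent family eventually decrease and
-- their limit is a C⋆-seminorm. A stage element enters as the family it generates.
theorem exists_isDirectedLimit : ∃ A : Cocone G, IsDirectedLimit A := by
  obtain ⟨A, _, q, hq, hn⟩ := exists_cstarAlgebra_of_ringSeminorm (coherent G)
    coherent.ringSeminorm
    (fun c x => tendsto_nhds_unique (coherent.tendsto_norm (c • x))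
      (((coherent.tendsto_norm x).const_mul ‖c‖).congr fun j => (norm_smul c (x.1 j)).symm))
    (fun x => tendsto_nhds_unique (coherent.tendsto_norm (star x * x))
      (((coherent.tendsto_norm x).mul (coherent.tendsto_norm x)).congr fun j =>
        (CStarRing.norm_star_mul_self (x := x.1 j)).symm))
  -- The seminorm sees only tails. Hence the arbitrary value 0 of `coherent.tail` outside the
  -- indices above `i` is harmless, and the legs are unital and multiplicative after applying `q`.
  have hext : ∀ (x y : coherent G) (i : J), (∀ j, i ≤ j → x.1 j = y.1 j) → q x = q y := by
    intro x y i h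
    rw [← sub_eq_zero, ← norm_eq_zero, ← map_sub, hn]
    refine tendsto_nhds_unique (coherent.tendsto_norm (x - y)) (tendsto_const_nhds.congr' ?_)
    filter_upwards [eventually_ge_atTop i] with j hj
    simp [h j hj]
  let π : ∀ i, G.obj i →⋆ₐ[ℂ] A := fun i =>
    { toFun := fun a => q (coherent.tail a)
      map_one' := by
        rw [← map_one q]
        refine hext _ _ i fun j hj => ?_
        rw [coherent.tail_apply _ hj, map_one]; rfl
      map_mul' := fun a b => by
        rw [← map_mul q]
        refine hext _ _ i fun j hj => ?_
        change _ = (coherent.tail a).1 j * (coherent.tail b).1 j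
        simp only [coherent.tail_apply _ hj, map_mul]
      map_zero' := by
        rw [← map_zero q]
        refine hext _ _ i fun j hj => ?_
        rw [coherent.tail_apply _ hj, map_zero]; rfl
      map_add' := fun a b => by
        rw [← map_add q]
        refine hext _ _ i fun j hj => ?_
        change _ = (coherent.tail a).1 j + (coherent.tail b).1 j
        simp only [coherent.tail_apply _ hj, map_add]
      commutes' := fun c => by
        rw [← AlgHomClass.commutes q c]
        refine hext _ _ i fun j hj => ?_
        rw [coherent.tail_apply _ hj]
        exact AlgHomClass.commutes _ c
      map_star' := fun a => by
        rw [← map_star q]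
        refine hext _ _ i fun j hj => ?_
        change _ = star ((coherent.tail a).1 j)
        simp only [coherent.tail_apply _ hj, map_star] }
  refine ⟨⟨⟨A⟩, { app := fun i => ⟨π i⟩, naturality := fun i j f => ?_ }⟩, ?_, ?_⟩
  · refine UnitalCStarAlg.Hom.ext (StarAlgHom.ext fun a => ?_)
    refine hext _ _ j fun k hk => ?_
    have hij : i ≤ j := leOfHom f
    rw [coherent.tail_apply _ hk, coherent.tail_apply _ (hij.trans hk), ← map_map G hij hk]
    rfl
  · refine hq.mono ?_
    rintro _ ⟨d, rfl⟩
    obtain ⟨i, hi⟩ := d.2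
    refine ⟨⟨i, d.1 i⟩, hext _ _ i fun j hj => ?_⟩
    rw [coherent.tail_apply _ hj, hi j hj]
  · intro i a c hc
    have ht := coherent.tendsto_norm (coherent.tail a)
    have hc' : coherent.limNorm (coherent.tail a) < c := (hn (coherent.tail a)).symm.trans_lt hc
    obtain ⟨k, hk, hik⟩ := ((ht.eventually_lt_const hc').and (eventually_ge_atTop i)).exists
    refine ⟨k, hik, ?_⟩
    rwa [coherent.tail_apply _ hik] at hk

namespace IsDirectedLimit

variable {A : Cocone G}

/-- A compatible family of bounded linear maps on an inductive system of C⋆-algebras extends to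
the limit. -/
theorem exists_extend (hA : IsDirectedLimit A) {V : Type*} [NormedAddCommGroup V] [NormedSpace ℂ V] [CompleteSpace V]
    (f : ∀ i, G.obj i →ₗ[ℂ] V)
    (hf : ∀ (i j : J) (h : i ≤ j) (a : G.obj i), f j ((G.map (homOfLE h)).hom a) = f i a)
    {C : ℝ} (hC : 0 ≤ C) (hfC : ∀ i a, ‖f i a‖ ≤ C * ‖a‖) :
    ∃ g : A.pt →L[ℂ] V, (∀ i a, g (leg A i a) = f i a) ∧ ∀ a, ‖g a‖ ≤ C * ‖a‖ := by
  classical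
  let e : (DirectSum J fun i => G.obj i) →ₗ[ℂ] A.pt :=
    DirectSum.toModule ℂ J A.pt fun i => ((leg A i).toAlgHom.toLinearMap : G.obj i →ₗ[ℂ] A.pt)
  let f' : (DirectSum J fun i => G.obj i) →ₗ[ℂ] V := DirectSum.toModule ℂ J V f
  have he : ∀ i a, e (DirectSum.lof ℂ J (fun i => G.obj i) i a) = leg A i a :=
    fun i a => DirectSum.toModule_lof ℂ (N := A.pt)
      (φ := fun i => ((leg A i).toAlgHom.toLinearMap : G.obj i →ₗ[ℂ] A.pt)) i a
  have hf' : ∀ i a, f' (DirectSum.lof ℂ J (fun i => G.obj i) i a) = f i a :=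
    fun i a => DirectSum.toModule_lof ℂ (N := V) (φ := f) i a
  -- By directedness, a finite sum of elements from several stages has the same two images as one
  -- element of a common stage, where the bound on `f` applies.
  have key : ∀ x, ∃ (k : J) (y : G.obj k), e x = leg A k y ∧ f' x = f k y := by
    intro x
    induction x using DirectSum.induction_on with
    | zero => exact ⟨Classical.arbitrary J, 0, by simp⟩
    | of i a => exact ⟨i, a, he i a, hf' i a⟩
    | add x y hx hy =>
      obtain ⟨i, a, h1, h2⟩ := hx
      obtain ⟨j, b, h3, h4⟩ := hy
      obtain ⟨k, hik, hjk⟩ := exists_ge_ge i j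
      refine ⟨k, (G.map (homOfLE hik)).hom a + (G.map (homOfLE hjk)).hom b, ?_, ?_⟩
      · rw [map_add, map_add, leg_map, leg_map, h1, h3]
      · rw [map_add, map_add, hf, hf, h2, h4]
  have hdense : DenseRange e := by
    refine hA.dense.mono ?_
    rintro _ ⟨p, rfl⟩
    exact ⟨_, he p.1 p.2⟩
  have hle : ∀ x, ‖f' x‖ ≤ C * ‖e x‖ := by
    intro x
    obtain ⟨k, y, h1, h2⟩ := key x
    rw [h1, h2]
    rw [← sub_nonneg]
    refine le_of_forall_pos_le_add fun ε hε => ?_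
    -- The denominator is `C + 1` because `C` may vanish.
    obtain ⟨l, hkl, hl⟩ := hA.exists_norm_lt k y (‖leg A k y‖ + ε / (C + 1))
      (lt_add_of_pos_right _ (by positivity))
    have h3 : ‖f k y‖ ≤ C * (‖leg A k y‖ + ε / (C + 1)) := by
      rw [← hf k l hkl]
      exact (hfC l _).trans (mul_le_mul_of_nonneg_left hl.le hC)
    have h4 : C * (ε / (C + 1)) ≤ ε := by
      rw [mul_div_assoc', div_le_iff₀ (by positivity)]
      nlinarith
    rw [mul_add] at h3
    linarith
  refine ⟨f'.extendOfNorm e, fun i a => ?_,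
    LinearMap.norm_extendOfNorm_apply_le hdense C hle⟩
  rw [← he, LinearMap.extendOfNorm_eq hdense ⟨C, hle⟩, hf']

/-- The legs of any cocone are contractive and extend with constant 1. Algebraic identities pass
from a common stage to the limit by continuity, and density gives uniqueness. -/
theorem isColimit (hA : IsDirectedLimit A) : Nonempty (IsColimit A) := by
  have h : ∀ s : Cocone G, ∃ g : A.pt ⟶ s.pt,
      ∀ i a, g.hom (leg A i a) = leg s i a := by
    intro s
    obtain ⟨g, hg, -⟩ := hA.exists_extend (V := s.pt)
      (fun i => (leg s i).toAlgHom.toLinearMap) (fun i j h a => leg_map s h a) zero_le_one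
      (fun i a => by simpa using! norm_leg_le s i a)
    have hg' : ∀ i a, g (leg A i a) = leg s i a := hg
    have hgc := g.continuous
    let i₀ := Classical.arbitrary J
    refine ⟨⟨{ toFun := g
               map_one' := ?_
               map_mul' := fun a b => ?_
               map_zero' := map_zero g
               map_add' := map_add g
               commutes' := fun c => ?_
               map_star' := fun a => ?_ }⟩, hg'⟩
    · rw [← map_one (leg A i₀), hg', map_one]
    · induction a using hA.induction with
      | hc => exact isClosed_eq (by fun_prop) (by fun_prop)
      | h i a =>
      induction b using hA.induction with
      | hc => exact isClosed_eq (by fun_prop) (by fun_prop)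
      | h j b =>
      obtain ⟨k, hik, hjk⟩ := exists_ge_ge i j
      rw [← leg_map A hik, ← leg_map A hjk, ← map_mul, hg', hg', hg', map_mul]
    · change g (algebraMap ℂ A.pt c) = _
      rw [Algebra.algebraMap_eq_smul_one, map_smul, ← map_one (leg A i₀), hg', map_one,
        Algebra.algebraMap_eq_smul_one]
    · induction a using hA.induction with
      | hc => exact isClosed_eq (by fun_prop) (by fun_prop)
      | h i a => rw [← map_star, hg', hg', map_star]
  choose g hg using h
  refine ⟨{ desc := g, fac := fun s j => ?_, uniq := fun s m hm => ?_ }⟩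
  · exact UnitalCStarAlg.Hom.ext (StarAlgHom.ext fun a => hg s j a)
  · refine UnitalCStarAlg.Hom.ext (StarAlgHom.ext fun a => ?_)
    have h1 : Continuous m.hom := (AddMonoidHomClass.continuous_of_bound m.hom 1
      fun a => by simpa using norm_hom_le m a)
    have h2 : Continuous (g s).hom := (AddMonoidHomClass.continuous_of_bound (g s).hom 1
      fun a => by simpa using norm_hom_le (g s) a)
    induction a using hA.induction with
    | hc => exact isClosed_eq h1 h2
    | h i a => rw [hg]; exact congrArg (fun f => UnitalCStarAlg.Hom.hom f a) (hm i)

end IsDirectedLimit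

/-- A colimit is isomorphic to the model; the isomorphism is continuous and onto, which transports
density, and its inverse is contractive, which transports the norm condition. -/
theorem isDirectedLimit_of_isColimit {A : Cocone G} (hA : IsColimit A) : IsDirectedLimit A := by
  obtain ⟨B, hB⟩ := exists_isDirectedLimit G
  obtain ⟨hB'⟩ := hB.isColimit
  let e := hB'.coconePointUniqueUpToIso hA
  have he : ∀ i a, e.hom.hom (leg B i a) = leg A i a := fun i a =>
    congrArg (fun f => UnitalCStarAlg.Hom.hom f a)
      (hB'.comp_coconePointUniqueUpToIso_hom hA i)
  have he' : ∀ i a, e.inv.hom (leg A i a) = leg B i a := fun i a =>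
    congrArg (fun f => UnitalCStarAlg.Hom.hom f a)
      (hB'.comp_coconePointUniqueUpToIso_inv hA i)
  have hc : Continuous e.hom.hom := AddMonoidHomClass.continuous_of_bound e.hom.hom 1
    fun a => by simpa using norm_hom_le e.hom a
  have hs : Function.Surjective e.hom.hom := fun a =>
    ⟨e.inv.hom a, by rw [← comp_hom_apply, e.inv_hom_id, id_hom_apply]⟩
  refine ⟨?_, fun i a c h => hB.exists_norm_lt i a c (lt_of_le_of_lt ?_ h)⟩
  · have := hs.denseRange.comp hB.dense hc
    refine this.mono ?_
    rintro _ ⟨p, rfl⟩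
    exact ⟨p, (he p.1 p.2).symm⟩
  · rw [← he' i a]
    exact norm_hom_le _ _

end UnitalCStarAlg

/-! ### Projective limits of operator spaces -/

theorem norm_toEuclideanCLM_single_le {n : ℕ} (i j : Fin n) :
    ‖Matrix.toEuclideanCLM (𝕜 := ℂ) (Matrix.single i j (1 : ℂ))‖ ≤ 1 := by
  refine ContinuousLinearMap.opNorm_le_bound _ zero_le_one fun v => ?_
  have : Matrix.toEuclideanCLM (𝕜 := ℂ) (Matrix.single i j (1 : ℂ)) v =
      EuclideanSpace.single i (v j) := by
    ext k
    rw [Matrix.ofLp_toEuclideanCLM]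
    simp [Matrix.single_mulVec, Function.update_apply]
  rw [this, PiLp.norm_single, one_mul]
  exact PiLp.norm_apply_le v j

namespace OperatorSpace

variable {X : Type u} [OperatorSpace X]

/-- Multiplication by matrix units, which are scalar contractions, moves an entry to any other
position. -/
theorem matNorm_single_le_matNorm_single {n : ℕ} (i j k l : Fin n) (x : X) :
    matNorm n (Matrix.single i j x) ≤ matNorm n (Matrix.single k l x) := by
  have h := matNorm_mul_le n (Matrix.single i k (1 : ℂ)) (Matrix.single l j (1 : ℂ))
    (Matrix.single k l x)
  have h1 : (Matrix.of fun a b : Fin n => ∑ c, ∑ d, (Matrix.single i k (1 : ℂ) a c *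
      Matrix.single l j (1 : ℂ) d b) • Matrix.single k l x c d) = Matrix.single i j x := by
    ext a b
    rw [Matrix.of_apply, Finset.sum_eq_single k, Finset.sum_eq_single l]
    · simp only [Matrix.single_apply]
      by_cases ha : i = a <;> by_cases hb : j = b <;> simp [ha, hb]
    · intro d _ hd; simp [Matrix.single_apply, hd.symm]
    · simp
    · intro d _ hd; simp [Matrix.single_apply, hd.symm]
    · simp
  rw [h1] at h
  refine h.trans ?_
  have h2 := norm_toEuclideanCLM_single_le i k
  have h3 := norm_toEuclideanCLM_single_le l j
  have h4 : 0 ≤ matNorm n (Matrix.single k l x) := apply_nonneg _ _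
  have h5 := mul_le_mul (mul_le_mul_of_nonneg_right h2 h4) h3 (norm_nonneg _)
    (mul_nonneg zero_le_one h4)
  rwa [one_mul, mul_one] at h5

/-- After moving the entry to the first corner, the matrix is `x ⊕ 0`, whose norm Ruan's sum axiom
computes. -/
theorem matNorm_single_le {n : ℕ} (i j : Fin n) (x : X) : matNorm n (Matrix.single i j x) ≤ ‖x‖ := by
  obtain ⟨m, rfl⟩ : ∃ m, n = 1 + m := ⟨n - 1, by have := i.pos; omega⟩
  let o : Fin (1 + m) := finSumFinEquiv (Sum.inl 0)
  refine (matNorm_single_le_matNorm_single i j o o x).trans ?_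
  have h := matNorm_sum 1 m (Matrix.of fun _ _ => x) 0
  have h1 : Matrix.reindex finSumFinEquiv finSumFinEquiv
      (Matrix.fromBlocks (Matrix.of fun _ _ : Fin 1 => x) 0 0 (0 : Matrix (Fin m) (Fin m) X)) =
      Matrix.single o o x := by
    ext a b
    obtain ⟨a, rfl⟩ := finSumFinEquiv.surjective a
    obtain ⟨b, rfl⟩ := finSumFinEquiv.surjective b
    rw [Matrix.reindex_apply, Matrix.submatrix_apply, Equiv.symm_apply_apply,
      Equiv.symm_apply_apply, Matrix.single_apply]
    simp only [o, EmbeddingLike.apply_eq_iff_eq]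
    rcases a with a | a <;> rcases b with b | b <;>
      simp [Fin.fin_one_eq_zero]
  rw [h1, matNorm_one, map_zero] at h
  rw [h]
  simp

/-- This makes the suprema of matrix norms over the stages finite: a bound on the entries of a
coherent family bounds all its matrix norms of a given size. -/
theorem matNorm_le_sum {n : ℕ} (x : Matrix (Fin n) (Fin n) X) :
    matNorm n x ≤ ∑ i, ∑ j, ‖x i j‖ := by
  conv_lhs => rw [Matrix.matrix_eq_sum_single x]
  refine (Finset.le_sum_of_subadditive (matNorm n) (map_zero _).le (map_add_le_add _) _ _).trans (Finset.sum_le_sum fun i _ => ?_)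
  exact (Finset.le_sum_of_subadditive (matNorm n) (map_zero _).le (map_add_le_add _) _ _).trans
    (Finset.sum_le_sum fun j _ => matNorm_single_le i j _)

end OperatorSpace

open OperatorSpace

namespace OpSp

theorem norm_hom_le {X Y : OpSp.{u}} (f : X ⟶ Y) (x : X) : ‖f.lin x‖ ≤ ‖x‖ := by
  have h := f.contr 1 (Matrix.of fun _ _ => x)
  rwa [matNorm_one, matNorm_one] at h

theorem comp_lin_apply {X Y Z : OpSp.{u}} (f : X ⟶ Y) (g : Y ⟶ Z) (x : X) :
    (f ≫ g).lin x = g.lin (f.lin x) := rfl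

theorem id_lin_apply {X : OpSp.{u}} (x : X) : OpSp.Hom.lin (𝟙 X) x = x := rfl

theorem hom_ext {X Y : OpSp.{u}} {f g : X ⟶ Y} (h : ∀ x, f.lin x = g.lin x) : f = g :=
  OpSp.Hom.ext (LinearMap.ext h)

variable {J : Type u} [Preorder J] (F : Jᵒᵖ ⥤ OpSp.{u})

theorem map_map {i j k : J} (hij : i ≤ j) (hjk : j ≤ k) (x : F.obj (op k)) :
    (F.map (homOfLE hij).op).lin ((F.map (homOfLE hjk).op).lin x) =
      (F.map (homOfLE (hij.trans hjk)).op).lin x := by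
  rw [← comp_lin_apply, ← F.map_comp, ← op_comp, homOfLE_comp]

theorem map_refl {i : J} (h : i ≤ i) (x : F.obj (op i)) : (F.map (homOfLE h).op).lin x = x := by
  have : (homOfLE h).op = 𝟙 (op i) := rfl
  rw [this, F.map_id, id_lin_apply]

/-- The leg `e^{j,∞}` of a cone of operator spaces as a linear map. -/
def leg {F : Jᵒᵖ ⥤ OpSp.{u}} (S : Cone F) (j : J) : S.pt →ₗ[ℂ] F.obj (op j) :=
  (S.π.app (op j)).lin

theorem map_leg {F : Jᵒᵖ ⥤ OpSp.{u}} (S : Cone F) {i j : J} (h : i ≤ j) (x : S.pt) :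
    (F.map (homOfLE h).op).lin (leg S j x) = leg S i x :=
  congrArg (fun f => OpSp.Hom.lin f x) (S.w (homOfLE h).op)

theorem norm_leg_le {F : Jᵒᵖ ⥤ OpSp.{u}} (S : Cone F) (j : J) (x : S.pt) : ‖leg S j x‖ ≤ ‖x‖ :=
  norm_hom_le (S.π.app (op j)) x

theorem matNorm_leg_le {F : Jᵒᵖ ⥤ OpSp.{u}} (S : Cone F) (j : J) {n : ℕ}
    (x : Matrix (Fin n) (Fin n) S.pt) : matNorm n (x.map (leg S j)) ≤ matNorm n x :=
  (S.π.app (op j)).contr n x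

/-- The bounded coherent families in a projective system of operator spaces. -/
def bounded : Submodule ℂ (lp (fun j : J => F.obj (op j)) ⊤) where
  carrier := {x | ∀ (i j : J) (h : i ≤ j), (F.map (homOfLE h).op).lin (x j) = x i}
  zero_mem' i j h := by simp
  add_mem' {x y} hx hy i j h := by
    simp only [lp.coeFn_add, Pi.add_apply, map_add, hx i j h, hy i j h]
  smul_mem' c x hx i j h := by
    simp only [lp.coeFn_smul, Pi.smul_apply, map_smul, hx i j h]

/-- Coherence is a closed condition because transition maps are contractive; completeness is then
inherited from the `ℓ^∞`-sum. -/
theorem isClosed_bounded : IsClosed (bounded F : Set (lp (fun j : J => F.obj (op j)) ⊤)) := by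
  have : (bounded F : Set (lp (fun j : J => F.obj (op j)) ⊤)) =
      ⋂ (i : J) (j : J) (h : i ≤ j), {x | (F.map (homOfLE h).op).lin (x j) = x i} := by
    ext x
    simp only [Set.mem_iInter]
    rfl
  rw [this]
  have hc : ∀ j, Continuous fun x : lp (fun j : J => F.obj (op j)) ⊤ => x j := fun j =>
    (lp.lipschitzWith_one_eval (E := fun j : J => F.obj (op j)) ⊤ j).continuous
  refine isClosed_iInter fun i => isClosed_iInter fun j => isClosed_iInter fun h => ?_
  have hl : Continuous (F.map (homOfLE h).op).lin :=
    AddMonoidHomClass.continuous_of_bound _ 1 fun a => by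
      simpa using norm_hom_le (F.map (homOfLE h).op) a
  exact isClosed_eq (hl.comp (hc j)) (hc i)

/-- The evaluation of bounded coherent families. -/
def bounded.eval (j : J) : bounded F →ₗ[ℂ] F.obj (op j) where
  toFun x := x.1 j
  map_add' _ _ := rfl
  map_smul' _ _ := rfl

theorem bounded.norm_eval_le (j : J) (x : bounded F) : ‖bounded.eval F j x‖ ≤ ‖x‖ :=
  lp.norm_apply_le_norm ENNReal.top_ne_zero x.1 j

/-- The matrix seminorms of the components of a bounded coherent family. -/
def bounded.evalSeminorm (n : ℕ) (j : J) : Seminorm ℂ (Matrix (Fin n) (Fin n) (bounded F)) :=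
  (matNorm n).comp (bounded.eval F j).mapMatrix

theorem bounded.bddAbove_evalSeminorm (n : ℕ) (x : Matrix (Fin n) (Fin n) (bounded F)) :
    BddAbove (Set.range fun j => evalSeminorm F n j x) := by
  refine ⟨∑ a, ∑ b, ‖x a b‖, ?_⟩
  rintro _ ⟨j, rfl⟩
  refine (matNorm_le_sum _).trans (Finset.sum_le_sum fun a _ => Finset.sum_le_sum fun b _ => ?_)
  exact norm_eval_le F j _

theorem bounded.iSup_evalSeminorm_apply (n : ℕ) (x : Matrix (Fin n) (Fin n) (bounded F)) :
    (⨆ j, evalSeminorm F n j) x = ⨆ j, evalSeminorm F n j x :=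
  Seminorm.iSup_apply (Seminorm.bddAbove_range_iff.2 (bddAbove_evalSeminorm F n))

theorem bounded.evalSeminorm_le (n : ℕ) (j : J) (x : Matrix (Fin n) (Fin n) (bounded F)) :
    evalSeminorm F n j x ≤ (⨆ j, evalSeminorm F n j) x := by
  rw [iSup_evalSeminorm_apply]
  exact le_ciSup (bddAbove_evalSeminorm F n x) j

theorem bounded.iSup_evalSeminorm_le [Nonempty J] {n : ℕ} {x : Matrix (Fin n) (Fin n) (bounded F)}
    {C : ℝ} (h : ∀ j, evalSeminorm F n j x ≤ C) : (⨆ j, evalSeminorm F n j) x ≤ C := by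
  rw [iSup_evalSeminorm_apply]
  exact ciSup_le h

/-- Ruan's axioms hold at each stage and survive suprema, since a supremum of maxima is the maximum
of the suprema. At size 1 the supremum is the `ℓ^∞`-norm. -/
instance [Nonempty J] : OperatorSpace (bounded F) where
  toCompleteSpace := (isClosed_bounded F).completeSpace_coe
  matNorm n := ⨆ j, bounded.evalSeminorm F n j
  eq_zero_of_matNorm n x hx := by
    refine Matrix.ext fun a b => Subtype.ext (lp.ext (funext fun j => ?_))
    have h := (bounded.evalSeminorm_le F n j x).trans_eq hx
    have h' := eq_zero_of_matNorm n _ (h.antisymm (apply_nonneg _ _))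
    exact congrFun (congrFun h' a) b
  matNorm_one x := by
    rw [bounded.iSup_evalSeminorm_apply]
    change _ = ⨆ j, _
    exact iSup_congr fun j => matNorm_one _
  matNorm_sum m n x y := by
    have h : ∀ j, bounded.evalSeminorm F (m + n) j
        (Matrix.reindex finSumFinEquiv finSumFinEquiv (Matrix.fromBlocks x 0 0 y)) =
        max (bounded.evalSeminorm F m j x) (bounded.evalSeminorm F n j y) := by
      intro j
      refine Eq.trans (congrArg (matNorm (m + n)) ?_) (matNorm_sum m n _ _)
      ext a b
      obtain ⟨a, rfl⟩ := finSumFinEquiv.surjective a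
      obtain ⟨b, rfl⟩ := finSumFinEquiv.surjective b
      rcases a with a | a <;> rcases b with b | b <;> simp
    refine le_antisymm (bounded.iSup_evalSeminorm_le F fun j => ?_) (max_le
      (bounded.iSup_evalSeminorm_le F fun j => ?_) (bounded.iSup_evalSeminorm_le F fun j => ?_))
    · rw [h]
      exact max_le_max (bounded.evalSeminorm_le F m j x) (bounded.evalSeminorm_le F n j y)
    · exact ((le_max_left _ _).trans_eq (h j).symm).trans (bounded.evalSeminorm_le F _ j _)
    · exact ((le_max_right _ _).trans_eq (h j).symm).trans (bounded.evalSeminorm_le F _ j _)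
  matNorm_mul_le n α β x := by
    refine bounded.iSup_evalSeminorm_le F fun j => ?_
    refine le_trans (le_of_eq ?_) ((matNorm_mul_le n α β (x.map (bounded.eval F j))).trans ?_)
    · refine congrArg (matNorm n) ?_
      ext a b
      simp
    · have := bounded.evalSeminorm_le F n j x
      gcongr
      exact this

/-- A cone over a projective system of operator spaces whose vertex carries the supremum of the
matrix norms and contains all bounded coherent families. -/
structure IsProjectiveLimit {F : Jᵒᵖ ⥤ OpSp.{u}} (S : Cone F) : Prop where
  matNorm_le : ∀ (n : ℕ) (x : Matrix (Fin n) (Fin n) S.pt) (C : ℝ),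
    (∀ j, matNorm n (x.map (leg S j)) ≤ C) → matNorm n x ≤ C
  exists_of_coherent : ∀ (x : ∀ j : J, F.obj (op j)) (C : ℝ), (∀ j, ‖x j‖ ≤ C) →
    (∀ (i j : J) (h : i ≤ j), (F.map (homOfLE h).op).lin (x j) = x i) →
    ∃ y : S.pt, ∀ j, leg S j y = x j

theorem exists_isProjectiveLimit [Nonempty J] : ∃ S : Cone F, IsProjectiveLimit S := by
  refine ⟨⟨⟨bounded F⟩,
    { app := fun j => ⟨bounded.eval F j.unop, fun n x => bounded.evalSeminorm_le F n j.unop x⟩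
      naturality := fun i j f => hom_ext fun x =>
        (x.2 _ _ (leOfHom f.unop)).symm }⟩, ?_, ?_⟩
  · intro n x C h
    exact bounded.iSup_evalSeminorm_le F h
  · intro x C hC hx
    exact ⟨⟨⟨x, memℓp_infty ⟨C, by rintro _ ⟨j, rfl⟩; exact hC j⟩⟩, hx⟩, fun j => rfl⟩

namespace IsProjectiveLimit

variable {F} {S : Cone F}

theorem norm_le (hS : IsProjectiveLimit S) {x : S.pt} {C : ℝ} (h : ∀ j, ‖leg S j x‖ ≤ C) :
    ‖x‖ ≤ C := by
  have := hS.matNorm_le 1 (Matrix.of fun _ _ => x) C fun j => by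
    rw [matNorm_one]
    exact h j
  rwa [matNorm_one] at this

theorem ext (hS : IsProjectiveLimit S) {x y : S.pt} (h : ∀ j, leg S j x = leg S j y) : x = y := by
  rw [← sub_eq_zero, ← norm_le_zero_iff]
  exact hS.norm_le fun j => by simp [h j]

/-- A coherent family of bounded linear maps lifts to the projective limit. -/
theorem exists_lift (hS : IsProjectiveLimit S) {V : Type*} [SeminormedAddCommGroup V]
    [Module ℂ V] (f : ∀ j : J, V →ₗ[ℂ] F.obj (op j)) (C : ℝ) (hC : ∀ j v, ‖f j v‖ ≤ C * ‖v‖)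
    (hf : ∀ (i j : J) (h : i ≤ j) (v : V), (F.map (homOfLE h).op).lin (f j v) = f i v) :
    ∃ g : V →ₗ[ℂ] S.pt, ∀ j v, leg S j (g v) = f j v := by
  choose g hg using fun v => hS.exists_of_coherent (fun j => f j v) (C * ‖v‖) (fun j => hC j v)
    (fun i j h => hf i j h v)
  exact ⟨{ toFun := g
           map_add' := fun v w => hS.ext fun j => by simp [hg]
           map_smul' := fun c v => hS.ext fun j => by simp [hg] }, fun j v => hg v j⟩

theorem isLimit (hS : IsProjectiveLimit S) : Nonempty (IsLimit S) := by
  have h : ∀ s : Cone F, ∃ g : s.pt ⟶ S.pt, ∀ j x, leg S j (g.lin x) = leg s j x := by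
    intro s
    obtain ⟨g, hg⟩ := hS.exists_lift (leg s) 1 (fun j v => by simpa using norm_leg_le s j v)
      (fun i j h v => map_leg s h v)
    refine ⟨⟨g, fun n x => hS.matNorm_le n _ _ fun j => ?_⟩, hg⟩
    refine le_trans (le_of_eq (congrArg (matNorm n) ?_)) (matNorm_leg_le s j x)
    ext a b
    exact hg j _
  choose g hg using h
  refine ⟨{ lift := g, fac := fun s j => hom_ext (hg s j.unop), uniq := fun s m hm => ?_ }⟩
  refine hom_ext fun x => hS.ext fun j => ?_
  rw [hg]
  exact congrArg (fun f => OpSp.Hom.lin f x) (hm (op j))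

end IsProjectiveLimit

/-- The comparison with the model has a completely contractive inverse, so matrix norm bounds and
the existence of coherent elements are transported. -/
theorem isProjectiveLimit_of_isLimit [Nonempty J] {F : Jᵒᵖ ⥤ OpSp.{u}} {S : Cone F}
    (hS : IsLimit S) : IsProjectiveLimit S := by
  obtain ⟨T, hT⟩ := exists_isProjectiveLimit F
  obtain ⟨hT'⟩ := hT.isLimit
  let e := hS.conePointUniqueUpToIso hT'
  have he : ∀ i x, leg T i (e.hom.lin x) = leg S i x := fun i x =>
    congrArg (fun f => OpSp.Hom.lin f x) (hS.conePointUniqueUpToIso_hom_comp hT' (op i))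
  have he' : ∀ i x, leg S i (e.inv.lin x) = leg T i x := fun i x =>
    congrArg (fun f => OpSp.Hom.lin f x) (hS.conePointUniqueUpToIso_inv_comp hT' (op i))
  constructor
  · intro n x C h
    have h1 : (x.map e.hom.lin).map e.inv.lin = x := by
      ext a b
      exact congrArg (fun f => OpSp.Hom.lin f (x a b)) e.hom_inv_id
    have h2 := e.inv.contr n (x.map e.hom.lin)
    rw [h1] at h2
    refine h2.trans (hT.matNorm_le n _ C fun j => ?_)
    refine le_trans (le_of_eq (congrArg (matNorm n) ?_)) (h j)
    ext a b
    exact he j _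
  · intro x C hC hx
    obtain ⟨y, hy⟩ := hT.exists_of_coherent x C hC hx
    exact ⟨e.inv.lin y, fun j => (he' j y).trans (hy j)⟩

end OpSp

/-! ### Actions on projective limits -/

section Action

variable {J : Type u} [Preorder J] [IsDirectedOrder J]
  {G : J ⥤ UnitalCStarAlg.{u}} {F : Jᵒᵖ ⥤ OpSp.{u}}

/-- Every leg factors through one above `i`. Thus identities involving an element of `A_i` need
testing only at stages where that element has an image. -/
theorem OpSp.IsProjectiveLimit.ext_of_ge {S : Cone F} (hS : IsProjectiveLimit S) (i : J)
    {x y : S.pt} (h : ∀ j, i ≤ j → leg S j x = leg S j y) : x = y := by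
  refine hS.ext fun j => ?_
  obtain ⟨k, hik, hjk⟩ := exists_ge_ge i j
  rw [← map_leg S hjk, ← map_leg S hjk, h k hik]

/-- A compatible family of contractive linear actions, evaluated at one element of one of the
algebras, acts on the projective limit. -/
theorem OpSp.IsProjectiveLimit.exists_action {S : Cone F} (hS : IsProjectiveLimit S)
    (t : ∀ j, G.obj j →ₗ[ℂ] Module.End ℂ (F.obj (op j)))
    (ht : ∀ j a x, ‖t j a x‖ ≤ ‖a‖ * ‖x‖)
    (hc : ∀ (i j : J) (h : i ≤ j) (a : G.obj i) (x : F.obj (op j)),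
      (F.map (homOfLE h).op).lin (t j ((G.map (homOfLE h)).hom a) x) =
        t i a ((F.map (homOfLE h).op).lin x)) (i : J) (a : G.obj i) :
    ∃ g : S.pt →L[ℂ] S.pt, ‖g‖ ≤ ‖a‖ ∧
      ∀ (k : J) (h : i ≤ k) (x : S.pt),
        leg S k (g x) = t k ((G.map (homOfLE h)).hom a) (leg S k x) := by
  choose k hik hjk using fun j => exists_ge_ge i j
  -- The `j`-th component of `a · x`: act at a chosen stage above both `i` and `j`, then map down.
  -- By `hf` any other such stage gives the same result.
  let f : ∀ j : J, S.pt →ₗ[ℂ] F.obj (op j) := fun j =>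
    (F.map (homOfLE (hjk j)).op).lin ∘ₗ t (k j) ((G.map (homOfLE (hik j))).hom a) ∘ₗ leg S (k j)
  have hf' : ∀ (j l m : J) (hil : i ≤ l) (hjl : j ≤ l) (hlm : l ≤ m) (x : S.pt),
      (F.map (homOfLE hjl).op).lin (t l ((G.map (homOfLE hil)).hom a) (leg S l x)) =
      (F.map (homOfLE (hjl.trans hlm)).op).lin
        (t m ((G.map (homOfLE (hil.trans hlm))).hom a) (leg S m x)) := by
    intro j l m hil hjl hlm x
    rw [← map_leg S hlm, ← hc, OpSp.map_map, UnitalCStarAlg.map_map]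
  have hf : ∀ (j l : J) (hil : i ≤ l) (hjl : j ≤ l) (x : S.pt), f j x =
      (F.map (homOfLE hjl).op).lin (t l ((G.map (homOfLE hil)).hom a) (leg S l x)) := by
    intro j l hil hjl x
    obtain ⟨m, h1, h2⟩ := exists_ge_ge (k j) l
    rw [hf' j l m hil hjl h2]
    exact hf' j (k j) m (hik j) (hjk j) h1 x
  have hb : ∀ j x, ‖f j x‖ ≤ ‖a‖ * ‖x‖ := fun j x =>
    (OpSp.norm_hom_le _ _).trans <| (ht _ _ _).trans <|
      mul_le_mul (UnitalCStarAlg.norm_hom_le _ _) (norm_leg_le S _ _) (norm_nonneg _)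
        (norm_nonneg _)
  obtain ⟨g, hg⟩ := hS.exists_lift f ‖a‖ hb fun j l h x => by
    obtain ⟨m, h1, h2⟩ := exists_ge_ge i l
    rw [hf l m h1 h2, hf j m h1 (h.trans h2), OpSp.map_map]
  refine ⟨g.mkContinuous ‖a‖ fun x => hS.norm_le fun j => by rw [hg]; exact hb j x,
    LinearMap.mkContinuous_norm_le _ (norm_nonneg _) _, fun k h x => ?_⟩
  rw [LinearMap.mkContinuous_apply, hg, hf k k h le_rfl, OpSp.map_refl]

/-- A compatible family of contractive linear actions of an inductive system of C⋆-algebras on a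
projective system of operator spaces induces an action of the limit on the limit. -/
theorem OpSp.IsProjectiveLimit.exists_limit_action [Nonempty J] {A : Cocone G}
    (hA : UnitalCStarAlg.IsDirectedLimit A) {S : Cone F} (hS : IsProjectiveLimit S)
    (t : ∀ j, G.obj j →ₗ[ℂ] Module.End ℂ (F.obj (op j)))
    (ht : ∀ j a x, ‖t j a x‖ ≤ ‖a‖ * ‖x‖)
    (hc : ∀ (i j : J) (h : i ≤ j) (a : G.obj i) (x : F.obj (op j)),
      (F.map (homOfLE h).op).lin (t j ((G.map (homOfLE h)).hom a) x) =
        t i a ((F.map (homOfLE h).op).lin x)) :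
    ∃ T : A.pt →L[ℂ] S.pt →L[ℂ] S.pt, (∀ a, ‖T a‖ ≤ ‖a‖) ∧
      ∀ (j : J) (a : G.obj j) (x : S.pt),
        leg S j (T (UnitalCStarAlg.leg A j a) x) = t j a (leg S j x) := by
  choose g hgn hg using hS.exists_action t ht hc
  -- The target of the extension is the Banach space of bounded operators on the limit space.
  obtain ⟨T, hT, hTn⟩ := hA.exists_extend
    (fun i => ({ toFun := g i
                 map_add' := fun a b => ContinuousLinearMap.ext fun x =>
                  hS.ext_of_ge i fun k hk => by simp [hg i _ k hk]
                 map_smul' := fun c a => ContinuousLinearMap.ext fun x =>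
                  hS.ext_of_ge i fun k hk => by simp [hg i _ k hk] } :
        G.obj i →ₗ[ℂ] S.pt →L[ℂ] S.pt))
    (fun i j h a => ContinuousLinearMap.ext fun x => hS.ext_of_ge j fun k hk => by
      simp [hg j _ k hk, hg i _ k (h.trans hk), UnitalCStarAlg.map_map])
    zero_le_one (fun i a => by simpa using hgn i a)
  refine ⟨T, fun a => by simpa using hTn a, fun j a x => ?_⟩
  rw [hT]
  exact (hg j a j le_rfl x).trans (by rw [UnitalCStarAlg.map_refl])

end Action

/-! ### One-sided actions and the bimodule structure on the limit -/

namespace ContractiveBimodule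

variable {A S : Type u} [CStarAlgebra A] [OperatorSpace S] (b : ContractiveBimodule A S)

theorem right_one : b.right (MulOpposite.op 1) = 1 := map_one b.right

theorem act_one_right (a : A) (x : S) : b.act a x 1 = b.left a x := by
  rw [act, right_one, Module.End.one_apply]

theorem act_one_left (x : S) (c : A) : b.act 1 x c = b.right (MulOpposite.op c) x := by
  rw [act, map_one, Module.End.one_apply]

theorem norm_left_le (a : A) (x : S) : ‖b.left a x‖ ≤ ‖a‖ * ‖x‖ := by
  have h := b.norm_le a 1 x
  rw [right_one, Module.End.one_apply] at h
  -- The unit has norm 1 only in a nonzero algebra; over the zero algebra both sides vanish.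
  rcases subsingleton_or_nontrivial A with hA | hA
  · have : a = 0 := Subsingleton.elim _ _
    simp [this]
  · simpa using h

theorem norm_right_le (c : A) (x : S) : ‖b.right (MulOpposite.op c) x‖ ≤ ‖c‖ * ‖x‖ := by
  have h := b.norm_le 1 c x
  rw [map_one, Module.End.one_apply] at h
  rcases subsingleton_or_nontrivial A with hA | hA
  · have : c = 0 := Subsingleton.elim _ _
    simp [this]
  · simpa [mul_comm] using h

theorem continuous_left_apply (x : S) : Continuous fun a => b.left a x :=
  AddMonoidHomClass.continuous_of_bound
    ((LinearMap.applyₗ x : Module.End ℂ S →ₗ[ℂ] S) ∘ₗ b.left.toLinearMap) ‖x‖ fun a => by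
      simpa [mul_comm] using b.norm_left_le a x

theorem continuous_right_apply (x : S) : Continuous fun c => b.right (MulOpposite.op c) x :=
  AddMonoidHomClass.continuous_of_bound
    ((LinearMap.applyₗ x : Module.End ℂ S →ₗ[ℂ] S) ∘ₗ b.right.toLinearMap ∘ₗ
      (MulOpposite.opLinearEquiv ℂ : A ≃ₗ[ℂ] Aᵐᵒᵖ).toLinearMap) ‖x‖ fun a => by
      simpa [mul_comm] using b.norm_right_le a x

end ContractiveBimodule

namespace CStarGraph

variable {J : Type u} [Preorder J] (F : Jᵒᵖ ⥤ CStarGraph.{u})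

theorem Hom.left_eq {G G' : CStarGraph.{u}} (f : G ⟶ G') (a : G'.alg) (x : G.space) :
    f.e.lin (G.bimod.left (f.π.hom a) x) = G'.bimod.left a (f.e.lin x) := by
  have h := f.act_eq a 1 x
  rw [map_one, ContractiveBimodule.act_one_right, ContractiveBimodule.act_one_right] at h
  exact h.symm

theorem Hom.right_eq {G G' : CStarGraph.{u}} (f : G ⟶ G') (a : G'.alg) (x : G.space) :
    f.e.lin (G.bimod.right (MulOpposite.op (f.π.hom a)) x) =
      G'.bimod.right (MulOpposite.op a) (f.e.lin x) := by
  have h := f.act_eq 1 a x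
  rw [map_one, ContractiveBimodule.act_one_left, ContractiveBimodule.act_one_left] at h
  exact h.symm

/-- The left action of the `j`-th algebra on the `j`-th space. -/
def leftAction (j : J) :
    (algSystem F).obj j →ₗ[ℂ] Module.End ℂ ((spaceSystem F).obj (op j)) :=
  (F.obj (op j)).bimod.left.toLinearMap

/-- The right action of the `j`-th algebra on the `j`-th space. -/
def rightAction (j : J) :
    (algSystem F).obj j →ₗ[ℂ] Module.End ℂ ((spaceSystem F).obj (op j)) :=
  (F.obj (op j)).bimod.right.toLinearMap ∘ₗ
    (MulOpposite.opLinearEquiv ℂ : (F.obj (op j)).alg ≃ₗ[ℂ] _).toLinearMap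

theorem norm_leftAction_le (j : J) (a : (algSystem F).obj j) (x : (spaceSystem F).obj (op j)) :
    ‖leftAction F j a x‖ ≤ ‖a‖ * ‖x‖ :=
  (F.obj (op j)).bimod.norm_left_le a x

theorem norm_rightAction_le (j : J) (a : (algSystem F).obj j)
    (x : (spaceSystem F).obj (op j)) : ‖rightAction F j a x‖ ≤ ‖a‖ * ‖x‖ :=
  (F.obj (op j)).bimod.norm_right_le a x

theorem map_leftAction (i j : J) (h : i ≤ j) (a : (algSystem F).obj i)
    (x : (spaceSystem F).obj (op j)) :
    ((spaceSystem F).map (homOfLE h).op).lin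
      (leftAction F j (((algSystem F).map (homOfLE h)).hom a) x) =
      leftAction F i a (((spaceSystem F).map (homOfLE h).op).lin x) :=
  (F.map (homOfLE h).op).left_eq a x

theorem map_rightAction (i j : J) (h : i ≤ j) (a : (algSystem F).obj i)
    (x : (spaceSystem F).obj (op j)) :
    ((spaceSystem F).map (homOfLE h).op).lin
      (rightAction F j (((algSystem F).map (homOfLE h)).hom a) x) =
      rightAction F i a (((spaceSystem F).map (homOfLE h).op).lin x) :=
  (F.map (homOfLE h).op).right_eq a x

variable {F} {A : Cocone (algSystem F)} {S : Cone (spaceSystem F)}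

open UnitalCStarAlg OpSp

/-- Since the legs are unital, putting 1 on one side separates the two-sided condition; composing
the one-sided ones recovers it. The left and right actions can thus be built independently. -/
theorem isCompatible_iff (b : ContractiveBimodule A.pt S.pt) :
    IsCompatible F A S b ↔
      (∀ (j : J) (a : (algSystem F).obj j) (x : S.pt),
        OpSp.leg S j (b.left (UnitalCStarAlg.leg A j a) x) =
          leftAction F j a (OpSp.leg S j x)) ∧
      (∀ (j : J) (a : (algSystem F).obj j) (x : S.pt),
        OpSp.leg S j (b.right (MulOpposite.op (UnitalCStarAlg.leg A j a)) x) =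
          rightAction F j a (OpSp.leg S j x)) := by
  constructor
  · intro h
    constructor
    · intro j a x
      have h1 : (F.obj (op j)).bimod.act a (OpSp.leg S j x) 1 = OpSp.leg S j
          (b.act (UnitalCStarAlg.leg A j a) x (UnitalCStarAlg.leg A j 1)) := h j a 1 x
      rw [map_one, ContractiveBimodule.act_one_right] at h1
      exact h1.symm.trans (ContractiveBimodule.act_one_right _ _ _)
    · intro j a x
      have h1 : (F.obj (op j)).bimod.act 1 (OpSp.leg S j x) a = OpSp.leg S j
          (b.act (UnitalCStarAlg.leg A j 1) x (UnitalCStarAlg.leg A j a)) := h j 1 a x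
      rw [map_one, ContractiveBimodule.act_one_left] at h1
      exact h1.symm.trans (ContractiveBimodule.act_one_left _ _ _)
  · rintro ⟨hl, hr⟩ j a c x
    exact ((hl j a _).trans (congrArg (leftAction F j a) (hr j c x))).symm

variable [IsDirectedOrder J] [Nonempty J]

theorem existsUnique_isCompatible (hA : IsDirectedLimit A) (hS : IsProjectiveLimit S) :
    ∃! b : ContractiveBimodule A.pt S.pt, IsCompatible F A S b := by
  obtain ⟨L, hLn, hL⟩ := hS.exists_limit_action hA (leftAction F) (norm_leftAction_le F)
    (map_leftAction F)
  obtain ⟨R, hRn, hR⟩ := hS.exists_limit_action hA (rightAction F) (norm_rightAction_le F)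
    (map_rightAction F)
  have hL1 : L 1 = 1 := ContinuousLinearMap.ext fun x => hS.ext fun j => by
    rw [← map_one (UnitalCStarAlg.leg A j), hL]
    exact congrArg (fun f : Module.End ℂ _ => f _) (map_one (F.obj (op j)).bimod.left)
  have hR1 : R 1 = 1 := ContinuousLinearMap.ext fun x => hS.ext fun j => by
    rw [← map_one (UnitalCStarAlg.leg A j), hR]
    exact congrArg (fun f : Module.End ℂ _ => f _) (map_one (F.obj (op j)).bimod.right)
  -- A relation closed in each variable separately holds everywhere once it holds for pairs coming
  -- from one common stage.
  have key : ∀ {P : A.pt → A.pt → Prop}, (∀ c, IsClosed {a | P a c}) →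
      (∀ a, IsClosed {c | P a c}) →
      (∀ (j : J) (a c : (algSystem F).obj j), P (UnitalCStarAlg.leg A j a)
        (UnitalCStarAlg.leg A j c)) → ∀ a c, P a c := by
    intro P h1 h2 h a c
    induction a using hA.induction with
    | hc => exact h1 c
    | h i a =>
    induction c using hA.induction with
    | hc => exact h2 _
    | h j c =>
    obtain ⟨k, hik, hjk⟩ := exists_ge_ge i j
    rw [← leg_map A hik, ← leg_map A hjk]
    exact h k _ _
  have hLm : ∀ a c, L (a * c) = L a * L c := by
    refine key (fun c => isClosed_eq (by fun_prop) (by fun_prop))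
      (fun c => isClosed_eq (by fun_prop) (by fun_prop)) fun j a c => ?_
    refine ContinuousLinearMap.ext fun x => hS.ext_of_ge j fun k hk => ?_
    rw [← leg_map A hk, ← leg_map A hk, ← map_mul, hL, mul_apply_eq_comp, hL, hL]
    exact congrArg (fun f : Module.End ℂ _ => f _) (map_mul (F.obj (op k)).bimod.left _ _)
  have hRm : ∀ a c, R (a * c) = R c * R a := by
    refine key (fun c => isClosed_eq (by fun_prop) (by fun_prop))
      (fun c => isClosed_eq (by fun_prop) (by fun_prop)) fun j a c => ?_
    refine ContinuousLinearMap.ext fun x => hS.ext_of_ge j fun k hk => ?_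
    rw [← leg_map A hk, ← leg_map A hk, ← map_mul, hR, mul_apply_eq_comp, hR, hR]
    exact congrArg (fun f : Module.End ℂ _ => f _) (map_mul (F.obj (op k)).bimod.right
      (MulOpposite.op _) (MulOpposite.op _))
  have hLR : ∀ a c, L a * R c = R c * L a := by
    refine key (fun c => isClosed_eq (by fun_prop) (by fun_prop))
      (fun c => isClosed_eq (by fun_prop) (by fun_prop)) fun j a c => ?_
    refine ContinuousLinearMap.ext fun x => hS.ext_of_ge j fun k hk => ?_
    rw [← leg_map A hk, ← leg_map A hk, mul_apply_eq_comp,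
      mul_apply_eq_comp, hL, hR, hR, hL]
    exact (F.obj (op k)).bimod.comm _ _ _
  let b : ContractiveBimodule A.pt S.pt :=
    { left := AlgHom.ofLinearMap
        ({ toFun := fun a => (L a).toLinearMap
           map_add' := fun a c => by rw [map_add]; rfl
           map_smul' := fun z a => by rw [map_smul]; rfl } : A.pt →ₗ[ℂ] Module.End ℂ S.pt)
        (congrArg ContinuousLinearMap.toLinearMap hL1)
        (fun a c => congrArg ContinuousLinearMap.toLinearMap (hLm a c))
      right := AlgHom.ofLinearMap
        ({ toFun := fun a => (R a.unop).toLinearMap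
           map_add' := fun a c => by rw [MulOpposite.unop_add, map_add]; rfl
           map_smul' := fun z a => by rw [MulOpposite.unop_smul, map_smul]; rfl } :
           (A.pt)ᵐᵒᵖ →ₗ[ℂ] Module.End ℂ S.pt)
        (congrArg ContinuousLinearMap.toLinearMap hR1)
        (fun a c => congrArg ContinuousLinearMap.toLinearMap (hRm c.unop a.unop))
      comm := fun a c x => congrArg (fun f : S.pt →L[ℂ] S.pt => f x) (hLR a c)
      norm_le := fun a c x => by
        change ‖L a (R c x)‖ ≤ _
        calc ‖L a (R c x)‖ ≤ ‖L a‖ * (‖R c‖ * ‖x‖) :=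
              (L a).le_opNorm_of_le ((R c).le_opNorm x)
          _ ≤ ‖a‖ * (‖c‖ * ‖x‖) := by
              have := hLn a; have := hRn c; gcongr
          _ = ‖a‖ * ‖x‖ * ‖c‖ := by ring }
  -- For uniqueness, compatibility fixes the action of stage elements, and contractivity of both
  -- structures gives continuity in the algebra variable.
  refine ⟨b, (isCompatible_iff b).2 ⟨hL, hR⟩, fun b' hb' => ?_⟩
  obtain ⟨hl, hr⟩ := (isCompatible_iff b').1 hb'
  refine ContractiveBimodule.ext (AlgHom.ext fun a => LinearMap.ext fun x => ?_)
    (AlgHom.ext fun a => LinearMap.ext fun x => ?_)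
  · induction a using hA.induction with
    | hc => exact isClosed_eq (b'.continuous_left_apply x) (b.continuous_left_apply x)
    | h i a =>
    refine hS.ext_of_ge i fun k hk => ?_
    rw [← leg_map A hk, hl]
    exact (hL k _ x).symm
  · induction a using MulOpposite.rec' with
    | h a =>
    induction a using hA.induction with
    | hc => exact isClosed_eq (b'.continuous_right_apply x) (b.continuous_right_apply x)
    | h i a =>
    refine hS.ext_of_ge i fun k hk => ?_
    rw [← leg_map A hk, hr]
    exact (hR k _ x).symm

end CStarGraph

/-! ### Matrix norms in inductive limits of C⋆-algebras -/

section CStarMatNorm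

attribute [local instance] CStarAlgebra.spectralOrder CStarAlgebra.spectralOrderedRing

theorem continuous_cstarMatNorm {A : Type u} [CStarAlgebra A] {n : ℕ} :
    Continuous (cstarMatNorm : Matrix (Fin n) (Fin n) A → ℝ) :=
  (continuous_norm (E := CStarMatrix (Fin n) (Fin n) A)).comp
    (CStarMatrix.ofMatrixL (m := Fin n) (n := Fin n) (A := A)).continuous

theorem cstarMatNorm_nonneg {A : Type u} [CStarAlgebra A] {n : ℕ}
    (a : Matrix (Fin n) (Fin n) A) : 0 ≤ cstarMatNorm a :=
  norm_nonneg (CStarMatrix.ofMatrix a)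

theorem norm_apply_le_cstarMatNorm {A : Type u} [CStarAlgebra A] {n : ℕ}
    (a : Matrix (Fin n) (Fin n) A) (i j : Fin n) : ‖a i j‖ ≤ cstarMatNorm a :=
  CStarMatrix.norm_entry_le_norm (M := CStarMatrix.ofMatrix a)

theorem cstarMatNorm_map_le {A B : Type u} [CStarAlgebra A] [CStarAlgebra B] (f : A →⋆ₐ[ℂ] B)
    {n : ℕ} (a : Matrix (Fin n) (Fin n) A) : cstarMatNorm (a.map f) ≤ cstarMatNorm a :=
  NonUnitalStarAlgHom.norm_apply_le
    (CStarMatrix.mapₙₐ (n := Fin n) (R := ℂ) (f : A →⋆ₙₐ[ℂ] B)) (CStarMatrix.ofMatrix a)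

theorem cstarMatNorm_add_le {A : Type u} [CStarAlgebra A] {n : ℕ}
    (a b : Matrix (Fin n) (Fin n) A) : cstarMatNorm (a + b) ≤ cstarMatNorm a + cstarMatNorm b :=
  norm_add_le (CStarMatrix.ofMatrix a) (CStarMatrix.ofMatrix b)

theorem cstarMatNorm_conjTranspose_mul_self {A : Type u} [CStarAlgebra A] {n : ℕ}
    (a : Matrix (Fin n) (Fin n) A) : cstarMatNorm (a.conjTranspose * a) = cstarMatNorm a ^ 2 :=
  (CStarRing.norm_star_mul_self (x := CStarMatrix.ofMatrix a)).trans (sq _).symm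

/-- Powers of the self-adjoint `a⋆a` have norms that are exactly powers, so a constant factor loses
its effect after extracting roots. -/
theorem cstarMatNorm_pow_two_pow {A : Type u} [CStarAlgebra A] {n : ℕ}
    (a : Matrix (Fin n) (Fin n) A) (m : ℕ) :
    cstarMatNorm ((a.conjTranspose * a) ^ 2 ^ m) = (cstarMatNorm a ^ 2) ^ 2 ^ m := by
  rw [← cstarMatNorm_conjTranspose_mul_self]
  have h : IsSelfAdjoint (star (CStarMatrix.ofMatrix a) * CStarMatrix.ofMatrix a) :=
    IsSelfAdjoint.star_mul_self _
  exact h.norm_pow_two_pow m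

/-- The corner embedding `a ↦ a ⊗ e_{jj}`. -/
def CStarMatrix.corner (A : Type u) [CStarAlgebra A] {n : ℕ} (j : Fin n) :
    A →⋆ₙₐ[ℂ] CStarMatrix (Fin n) (Fin n) A where
  toFun a := CStarMatrix.ofMatrix (Matrix.single j j a)
  map_smul' c a := (Matrix.smul_single c j j a).symm
  map_zero' := Matrix.single_zero j j
  map_add' a b := Matrix.single_add j j a b
  map_mul' a b := (Matrix.single_mul_single_same a j j j b).symm
  map_star' a := (Matrix.conjTranspose_single j j a).symm

/-- The C⋆-identity replaces the entry by `a⋆a` on the diagonal, where the corner embedding is a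
⋆-homomorphism and hence contractive. -/
theorem cstarMatNorm_single_le {A : Type u} [CStarAlgebra A] {n : ℕ} (i j : Fin n) (a : A) :
    cstarMatNorm (Matrix.single i j a) ≤ ‖a‖ := by
  refine le_of_sq_le_sq ?_ (norm_nonneg a)
  rw [← cstarMatNorm_conjTranspose_mul_self, Matrix.conjTranspose_single,
    Matrix.single_mul_single_same, sq, ← CStarRing.norm_star_mul_self]
  exact NonUnitalStarAlgHom.norm_apply_le (CStarMatrix.corner A j) (star a * a)

theorem cstarMatNorm_le_sum {A : Type u} [CStarAlgebra A] {n : ℕ}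
    (a : Matrix (Fin n) (Fin n) A) : cstarMatNorm a ≤ ∑ i, ∑ j, ‖a i j‖ := by
  have h0 : cstarMatNorm (0 : Matrix (Fin n) (Fin n) A) ≤ 0 :=
    (norm_zero (E := CStarMatrix (Fin n) (Fin n) A)).le
  conv_lhs => rw [Matrix.matrix_eq_sum_single a]
  refine (Finset.le_sum_of_subadditive cstarMatNorm h0 cstarMatNorm_add_le _ _).trans
    (Finset.sum_le_sum fun i _ => ?_)
  exact (Finset.le_sum_of_subadditive cstarMatNorm h0 cstarMatNorm_add_le _ _).trans
    (Finset.sum_le_sum fun j _ => cstarMatNorm_single_le i j _)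

theorem cstarMatNorm_one_by_one {A : Type u} [CStarAlgebra A] (a : Matrix (Fin 1) (Fin 1) A) :
    cstarMatNorm a = ‖a 0 0‖ :=
  ((cstarMatNorm_le_sum a).trans_eq (by simp)).antisymm (norm_apply_le_cstarMatNorm a 0 0)

end CStarMatNorm

namespace UnitalCStarAlg.IsDirectedLimit

variable {J : Type u} [Preorder J] [IsDirectedOrder J] {G : J ⥤ UnitalCStarAlg.{u}}
  {A : Cocone G}

/-- Every matrix over a stage of the system becomes small entrywise as soon as its image in the
limit does. -/
theorem exists_entry_norm_lt (hA : IsDirectedLimit A) {n : ℕ} {i : J}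
    (a : Matrix (Fin n) (Fin n) (G.obj i)) {c : ℝ} (hc : ∀ p q, ‖leg A i (a p q)‖ < c) :
    ∃ (k : J) (h : i ≤ k), ∀ p q, ‖(G.map (homOfLE h)).hom (a p q)‖ < c := by
  choose k hk hlt using fun pq : Fin n × Fin n => hA.exists_norm_lt i (a pq.1 pq.2) c (hc _ _)
  have : Nonempty J := ⟨i⟩
  obtain ⟨l, hl⟩ := (Set.finite_range k).bddAbove
  obtain ⟨m, him, hlm⟩ := exists_ge_ge i l
  refine ⟨m, him, fun p q => ?_⟩
  have hkm : k (p, q) ≤ m := (hl ⟨_, rfl⟩).trans hlm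
  rw [← map_map G (hk (p, q)) hkm]
  exact (norm_hom_le _ _).trans_lt (hlt (p, q))

/-- `‖π_{i,∞} a‖ = inf_k ‖π_{i,k} a‖` for matrices. -/
theorem exists_cstarMatNorm_lt (hA : IsDirectedLimit A) {n : ℕ} {i : J}
    (a : Matrix (Fin n) (Fin n) (G.obj i)) {c : ℝ} (hc : cstarMatNorm (a.map (leg A i)) < c) :
    ∃ (k : J) (h : i ≤ k), cstarMatNorm (a.map (G.map (homOfLE h)).hom) < c := by
  set r := cstarMatNorm (a.map (leg A i)) with hr
  have hr0 : 0 ≤ r := cstarMatNorm_nonneg _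
  have hc0 : 0 < c := hr0.trans_lt hc
  have hpow : ∀ {B : UnitalCStarAlg.{u}} (f : G.obj i →⋆ₐ[ℂ] B) (m : ℕ),
      ((a.conjTranspose * a) ^ 2 ^ m).map f =
        ((a.map f).conjTranspose * a.map f) ^ 2 ^ m := by
    intro B f m
    have h1 := map_pow (f : G.obj i →+* B).mapMatrix (a.conjTranspose * a) (2 ^ m)
    rw [map_mul] at h1
    refine h1.trans (congrArg (fun x => (x * a.map f) ^ 2 ^ m) ?_)
    ext p q
    exact map_star f (a q p)
  -- Matrix norm and largest entry differ by a factor at most `n²`. As `r < c`, a large power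
  -- creates a gap exceeding this factor; `n * n + 1` keeps the denominator positive for `n = 0` and
  -- the final estimate strict.
  obtain ⟨m, hm⟩ : ∃ m : ℕ, (n * n + 1 : ℝ) * (r ^ 2) ^ 2 ^ m < (c ^ 2) ^ 2 ^ m := by
    have h1 : r ^ 2 / c ^ 2 < 1 := by
      rw [div_lt_one (by positivity)]
      gcongr
    obtain ⟨m, hm⟩ := exists_pow_lt_of_lt_one (show (0 : ℝ) < 1 / (n * n + 1) by positivity) h1
    refine ⟨m, ?_⟩
    have h2 : (r ^ 2 / c ^ 2) ^ 2 ^ m < 1 / (n * n + 1) :=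
      (pow_le_pow_of_le_one (by positivity) h1.le Nat.lt_two_pow_self.le).trans_lt hm
    rw [div_pow, div_lt_div_iff₀ (by positivity) (by positivity), one_mul] at h2
    linarith
  have hlt : ∀ p q, ‖leg A i (((a.conjTranspose * a) ^ 2 ^ m) p q)‖ <
      (c ^ 2) ^ 2 ^ m / (n * n + 1) := by
    intro p q
    refine (norm_apply_le_cstarMatNorm
      (((a.conjTranspose * a) ^ 2 ^ m).map (leg A i)) p q).trans_lt ?_
    rw [hpow, cstarMatNorm_pow_two_pow, lt_div_iff₀ (by positivity), mul_comm]
    exact hm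
  obtain ⟨k, hik, hk⟩ := hA.exists_entry_norm_lt _ hlt
  refine ⟨k, hik, ?_⟩
  have h3 := cstarMatNorm_le_sum (((a.conjTranspose * a) ^ 2 ^ m).map (G.map (homOfLE hik)).hom)
  rw [hpow, cstarMatNorm_pow_two_pow] at h3
  have h4 : ∑ p, ∑ q, ‖(((a.conjTranspose * a) ^ 2 ^ m).map (G.map (homOfLE hik)).hom) p q‖ ≤
      ∑ _p : Fin n, ∑ _q : Fin n, (c ^ 2) ^ 2 ^ m / (n * n + 1) :=
    Finset.sum_le_sum fun p _ => Finset.sum_le_sum fun q _ => (hk p q).le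
  have h5 : ∑ _p : Fin n, ∑ _q : Fin n, (c ^ 2) ^ 2 ^ m / (n * n + 1 : ℝ) < (c ^ 2) ^ 2 ^ m := by
    simp only [Finset.sum_const, Finset.card_univ, Fintype.card_fin, nsmul_eq_mul]
    rw [← mul_assoc, mul_div_assoc', div_lt_iff₀ (by positivity)]
    have : 0 < (c ^ 2) ^ 2 ^ m := by positivity
    nlinarith
  rw [← hpow] at h3
  have h6 := (h3.trans h4).trans_lt h5
  rw [← pow_mul, ← pow_mul] at h6
  exact lt_of_pow_lt_pow_left₀ _ hc0.le h6

end UnitalCStarAlg.IsDirectedLimit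

/-! ### Norms of matrices of operators -/

section OpMatNorm

variable {H K : Type u} [NormedAddCommGroup H] [InnerProductSpace ℂ H]
  [NormedAddCommGroup K] [InnerProductSpace ℂ K] {n : ℕ}

/-- The operator of a matrix of operators. -/
def matOp (T : Matrix (Fin n) (Fin n) (H →L[ℂ] K)) :
    PiLp 2 (fun _ : Fin n => H) →L[ℂ] PiLp 2 (fun _ : Fin n => K) :=
  (PiLp.continuousLinearEquiv 2 ℂ (fun _ : Fin n => K)).symm.toContinuousLinearMap ∘L
      (ContinuousLinearMap.pi fun i => ∑ j, T i j ∘L PiLp.proj 2 (fun _ : Fin n => H) j)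

theorem opMatNorm_nonneg (T : Matrix (Fin n) (Fin n) (H →L[ℂ] K)) : 0 ≤ opMatNorm T :=
  norm_nonneg (matOp T)

theorem matOp_apply (T : Matrix (Fin n) (Fin n) (H →L[ℂ] K)) (v : PiLp 2 (fun _ : Fin n => H))
    (i : Fin n) : matOp T v i = ∑ j, T i j (v j) := by
  simp [matOp]

theorem sq_norm_matOp_apply (T : Matrix (Fin n) (Fin n) (H →L[ℂ] K))
    (v : PiLp 2 (fun _ : Fin n => H)) : ‖matOp T v‖ ^ 2 = ∑ i, ‖∑ j, T i j (v j)‖ ^ 2 := by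
  rw [PiLp.norm_sq_eq_of_L2]
  simp only [matOp_apply]

theorem sum_sq_norm_le (T : Matrix (Fin n) (Fin n) (H →L[ℂ] K)) {C : ℝ} (hC : opMatNorm T ≤ C)
    (v : Fin n → H) : ∑ i, ‖∑ j, T i j (v j)‖ ^ 2 ≤ C ^ 2 * ∑ j, ‖v j‖ ^ 2 := by
  have h := (matOp T).le_of_opNorm_le hC (WithLp.toLp 2 v)
  have h2 := pow_le_pow_left₀ (norm_nonneg _) h 2
  rw [sq_norm_matOp_apply, mul_pow, PiLp.norm_sq_eq_of_L2] at h2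
  exact h2

/-- In this form the bound involves only finitely many vector norms, so it passes to limits along an
ultrafilter. -/
theorem opMatNorm_le_iff (T : Matrix (Fin n) (Fin n) (H →L[ℂ] K)) {C : ℝ} (hC : 0 ≤ C) :
    opMatNorm T ≤ C ↔
      ∀ v : Fin n → H, ∑ i, ‖∑ j, T i j (v j)‖ ^ 2 ≤ C ^ 2 * ∑ j, ‖v j‖ ^ 2 := by
  refine ⟨fun h v => sum_sq_norm_le T h v, fun h => ?_⟩
  refine (matOp T).opNorm_le_bound hC fun v => le_of_sq_le_sq ?_ (by positivity)
  rw [sq_norm_matOp_apply, mul_pow, PiLp.norm_sq_eq_of_L2]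
  exact h _

theorem exists_lt_sum_sq_norm (T : Matrix (Fin n) (Fin n) (H →L[ℂ] K)) {c : ℝ} (hc : 0 ≤ c)
    (h : c < opMatNorm T) :
    ∃ v : Fin n → H, ∑ j, ‖v j‖ ^ 2 ≤ 1 ∧ c ^ 2 ≤ ∑ i, ‖∑ j, T i j (v j)‖ ^ 2 := by
  obtain ⟨v, hv, hcv⟩ := (matOp T).exists_lt_apply_of_lt_opNorm h
  refine ⟨v, ?_, ?_⟩
  · rw [← PiLp.norm_sq_eq_of_L2]
    exact pow_le_one₀ (norm_nonneg v) hv.le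
  · rw [← sq_norm_matOp_apply]
    exact pow_le_pow_left₀ hc hcv.le 2

theorem norm_le_opMatNorm_one (T : Matrix (Fin 1) (Fin 1) (H →L[ℂ] K)) :
    ‖T 0 0‖ ≤ opMatNorm T := by
  refine (T 0 0).opNorm_le_bound (opMatNorm_nonneg T) fun x =>
    le_of_sq_le_sq ?_ (mul_nonneg (opMatNorm_nonneg T) (norm_nonneg x))
  have := sum_sq_norm_le T le_rfl fun _ => x
  simpa [mul_pow] using this

end OpMatNorm

/-! ### Ultraproducts of Hilbert spaces -/

theorem Ultrafilter.exists_tendsto_of_bounded {J : Type*} (U : Ultrafilter J) {f : J → ℝ} {C : ℝ}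
    (h : ∀ j, |f j| ≤ C) : ∃ l, Tendsto f U (𝓝 l) := by
  obtain ⟨l, -, hl⟩ := (isCompact_Icc (a := -C) (b := C)).ultrafilter_le_nhds (U.map f)
    (by
      rw [Ultrafilter.coe_map, le_principal_iff, Filter.mem_map]
      exact univ_mem' fun j => abs_le.1 (h j))
  exact ⟨l, hl⟩

/-- `q` exhibits `L` as the ultraproduct of the Hilbert spaces `H j`. -/
structure IsUltraproduct {J : Type u} (U : Ultrafilter J) {H : J → Type u}
    [∀ j, NormedAddCommGroup (H j)] [∀ j, InnerProductSpace ℂ (H j)] {L : Type u}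
    [NormedAddCommGroup L] [InnerProductSpace ℂ L] (q : lp H ⊤ →ₗ[ℂ] L) : Prop where
  dense : DenseRange q
  tendsto : ∀ x, Tendsto (fun j => ‖x j‖) U (𝓝 ‖q x‖)

section Ultraproduct

variable {J : Type u} (U : Ultrafilter J)

/-- Bounded real families converge along an ultrafilter. The limit of the norms is a seminorm, and
the parallelogram law passes to it from the factors. -/
theorem exists_isUltraproduct (H : J → Type u) [∀ j, NormedAddCommGroup (H j)]
    [∀ j, InnerProductSpace ℂ (H j)] :
    ∃ (L : Type u) (_ : NormedAddCommGroup L) (_ : InnerProductSpace ℂ L) (_ : CompleteSpace L)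
      (q : lp H ⊤ →ₗ[ℂ] L), IsUltraproduct U q := by
  choose p hp using fun x : lp H ⊤ => U.exists_tendsto_of_bounded (f := fun j => ‖x j‖)
    (C := ‖x‖) fun j => by
      rw [abs_norm]; exact lp.norm_apply_le_norm ENNReal.top_ne_zero x j
  let P : Seminorm ℂ (lp H ⊤) := Seminorm.of p
    (fun x y => le_of_tendsto_of_tendsto' (hp _) ((hp x).add (hp y)) fun j => norm_add_le _ _)
    (fun c x => tendsto_nhds_unique (hp _)
      (((hp x).const_mul ‖c‖).congr fun j => (norm_smul c (x j)).symm))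
  obtain ⟨L, i1, i2, i3, q, hq, hn⟩ := exists_hilbert_of_seminorm (lp H ⊤) P fun x y => by
    refine tendsto_nhds_unique (((hp (x + y)).mul (hp (x + y))).add
      ((hp (x - y)).mul (hp (x - y)))) ?_
    refine ((((hp x).mul (hp x)).add ((hp y).mul (hp y))).const_mul 2).congr fun j => ?_
    simpa only [sq] using! (parallelogram_law_with_norm ℂ (x j) (y j)).symm
  exact ⟨L, i1, i2, i3, q, hq, fun x => by rw [hn]; exact hp x⟩

variable {U} {H K M : J → Type u} [∀ j, NormedAddCommGroup (H j)]
  [∀ j, InnerProductSpace ℂ (H j)] [∀ j, NormedAddCommGroup (K j)]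
  [∀ j, InnerProductSpace ℂ (K j)] [∀ j, NormedAddCommGroup (M j)]
  [∀ j, InnerProductSpace ℂ (M j)]
  {L L' L'' : Type u} [NormedAddCommGroup L] [InnerProductSpace ℂ L]
  [NormedAddCommGroup L'] [InnerProductSpace ℂ L']
  [NormedAddCommGroup L''] [InnerProductSpace ℂ L'']
  {q : lp H ⊤ →ₗ[ℂ] L} {q' : lp K ⊤ →ₗ[ℂ] L'} {q'' : lp M ⊤ →ₗ[ℂ] L''}

theorem IsUltraproduct.map_congr (hq : IsUltraproduct U q) {x y : lp H ⊤}
    (h : ∀ᶠ j in U, x j = y j) : q x = q y := by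
  rw [← sub_eq_zero, ← norm_eq_zero, ← map_sub]
  refine tendsto_nhds_unique (hq.tendsto (x - y)) (tendsto_const_nhds.congr' ?_)
  filter_upwards [h] with j hj
  simp [hj]

theorem IsUltraproduct.clm_ext (hq : IsUltraproduct U q) {f g : L →L[ℂ] L'}
    (h : ∀ x, f (q x) = g (q x)) : f = g :=
  DFunLike.coe_injective (hq.dense.equalizer f.continuous g.continuous (funext h))

/-- A bounded family of vectors as an element of the `ℓ^∞`-sum. -/
def lpMk (x : ∀ j, H j) (C : ℝ) (hC : ∀ j, ‖x j‖ ≤ C) : lp H ⊤ :=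
  ⟨x, memℓp_infty ⟨C, by rintro _ ⟨j, rfl⟩; exact hC j⟩⟩

/-- A bounded family of operators acts on bounded families of vectors. -/
def lpApply (T : lp (fun j => H j →L[ℂ] K j) ⊤) : lp H ⊤ →ₗ[ℂ] lp K ⊤ where
  toFun x := ⟨fun j => T j (x j), memℓp_infty ⟨‖T‖ * ‖x‖, by
    rintro _ ⟨j, rfl⟩
    exact (T j).le_of_opNorm_le_of_le (lp.norm_apply_le_norm ENNReal.top_ne_zero T j)
      (lp.norm_apply_le_norm ENNReal.top_ne_zero x j)⟩⟩
  map_add' x y := lp.ext (funext fun j => map_add (T j) (x j) (y j))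
  map_smul' c x := lp.ext (funext fun j => map_smul (T j) c (x j))

theorem lpApply_apply (T : lp (fun j => H j →L[ℂ] K j) ⊤) (x : lp H ⊤) (j : J) :
    lpApply T x j = T j (x j) := rfl

/-- `Φ` sends a bounded family of operators to its ultraproduct. -/
def IsUltraproductMap (q : lp H ⊤ →ₗ[ℂ] L) (q' : lp K ⊤ →ₗ[ℂ] L')
    (Φ : lp (fun j => H j →L[ℂ] K j) ⊤ →ₗ[ℂ] L →L[ℂ] L') : Prop :=
  ∀ T w, Φ T (q w) = q' (lpApply T w)

/-- The componentwise operator is bounded for the limit seminorms, hence descends to the dense image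
and extends. -/
theorem IsUltraproduct.exists_map [CompleteSpace L'] (hq : IsUltraproduct U q)
    (hq' : IsUltraproduct U q') :
    ∃ Φ : lp (fun j => H j →L[ℂ] K j) ⊤ →ₗ[ℂ] L →L[ℂ] L', IsUltraproductMap q q' Φ ∧
      ∀ T, ‖Φ T‖ ≤ ‖T‖ := by
  have hle : ∀ (T : lp (fun j => H j →L[ℂ] K j) ⊤) (x : lp H ⊤),
      ‖(q' ∘ₗ lpApply T) x‖ ≤ ‖T‖ * ‖q x‖ := fun T x =>
    le_of_tendsto_of_tendsto' (hq'.tendsto _) ((hq.tendsto x).const_mul ‖T‖) fun j =>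
      (T j).le_of_opNorm_le (lp.norm_apply_le_norm ENNReal.top_ne_zero T j) (x j)
  let Φ : lp (fun j => H j →L[ℂ] K j) ⊤ → L →L[ℂ] L' := fun T =>
    (q' ∘ₗ lpApply T).extendOfNorm q
  have hΦ : ∀ T x, Φ T (q x) = q' (lpApply T x) := fun T x =>
    LinearMap.extendOfNorm_eq hq.dense ⟨‖T‖, hle T⟩ x
  refine ⟨{ toFun := Φ, map_add' := fun S T => hq.clm_ext fun x => ?_,
            map_smul' := fun c T => hq.clm_ext fun x => ?_ }, hΦ, fun T => ?_⟩
  · rw [add_apply, hΦ, hΦ, hΦ, ← map_add]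
    rfl
  · rw [RingHom.id_apply, smul_apply, hΦ, hΦ, ← map_smul]
    rfl
  · exact ContinuousLinearMap.opNorm_le_bound _ (norm_nonneg T)
      (LinearMap.norm_extendOfNorm_apply_le hq.dense ‖T‖ (hle T))

namespace IsUltraproductMap

variable {Φ : lp (fun j => H j →L[ℂ] K j) ⊤ →ₗ[ℂ] L →L[ℂ] L'}

theorem map_congr (hΦ : IsUltraproductMap q q' Φ) (hq : IsUltraproduct U q)
    (hq' : IsUltraproduct U q') {T T' : lp (fun j => H j →L[ℂ] K j) ⊤}
    (h : ∀ᶠ j in U, T j = T' j) : Φ T = Φ T' := by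
  refine hq.clm_ext fun x => ?_
  rw [hΦ, hΦ]
  refine hq'.map_congr ?_
  filter_upwards [h] with j hj
  rw [lpApply_apply, lpApply_apply, hj]

theorem map_comp {Ψ : lp (fun j => K j →L[ℂ] M j) ⊤ →ₗ[ℂ] L' →L[ℂ] L''}
    {Θ : lp (fun j => H j →L[ℂ] M j) ⊤ →ₗ[ℂ] L →L[ℂ] L''}
    (hΦ : IsUltraproductMap q q' Φ) (hΨ : IsUltraproductMap q' q'' Ψ)
    (hΘ : IsUltraproductMap q q'' Θ) (hq : IsUltraproduct U q) (hq'' : IsUltraproduct U q'')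
    {T : lp (fun j => H j →L[ℂ] K j) ⊤} {S : lp (fun j => K j →L[ℂ] M j) ⊤}
    {R : lp (fun j => H j →L[ℂ] M j) ⊤} (h : ∀ᶠ j in U, R j = S j ∘L T j) :
    Θ R = Ψ S ∘L Φ T := by
  refine hq.clm_ext fun x => ?_
  rw [ContinuousLinearMap.comp_apply, hΦ, hΨ, hΘ]
  refine hq''.map_congr ?_
  filter_upwards [h] with j hj
  rw [lpApply_apply, lpApply_apply, lpApply_apply, hj]
  rfl

theorem tendsto_sum_sq_norm (hΦ : IsUltraproductMap q q' Φ) (hq' : IsUltraproduct U q') {n : ℕ}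
    (T : Matrix (Fin n) (Fin n) (lp (fun j => H j →L[ℂ] K j) ⊤)) (w : Fin n → lp H ⊤) :
    Tendsto (fun j => ∑ a, ‖∑ b, T a b j (w b j)‖ ^ 2) U
      (𝓝 (∑ a, ‖∑ b, T.map Φ a b (q (w b))‖ ^ 2)) := by
  refine tendsto_finsetSum _ fun a _ => Tendsto.pow ?_ 2
  have h := hq'.tendsto (∑ b, lpApply (T a b) (w b))
  rw [map_sum] at h
  have hT : ∀ b, T.map Φ a b (q (w b)) = q' (lpApply (T a b) (w b)) := fun b => hΦ _ _
  simp only [hT]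
  refine h.congr fun j => ?_
  rw [lp.coeFn_sum, Finset.sum_apply]
  rfl

theorem opMatNorm_le (hΦ : IsUltraproductMap q q' Φ) (hq : IsUltraproduct U q)
    (hq' : IsUltraproduct U q') {n : ℕ}
    (T : Matrix (Fin n) (Fin n) (lp (fun j => H j →L[ℂ] K j) ⊤)) {C : ℝ}
    (h : ∀ᶠ j in U, opMatNorm (T.map fun t => t j) ≤ C) : opMatNorm (T.map Φ) ≤ C := by
  have hC : 0 ≤ C := by
    obtain ⟨j, hj⟩ := h.exists
    exact (opMatNorm_nonneg _).trans hj
  rw [opMatNorm_le_iff _ hC]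
  intro v
  have hd : DenseRange (Pi.map fun _ : Fin n => (q : lp H ⊤ → L)) :=
    DenseRange.piMap fun _ => hq.dense
  induction v using hd.induction_on with
  | hp => exact isClosed_le (by fun_prop) (by fun_prop)
  | ih w =>
    refine le_of_tendsto_of_tendsto (hΦ.tendsto_sum_sq_norm hq' T w)
      ((tendsto_finsetSum _ fun b _ => (hq.tendsto (w b)).pow 2).const_mul (C ^ 2)) ?_
    filter_upwards [h] with j hj
    exact sum_sq_norm_le _ hj fun b => w b j

/-- Almost norming unit-ball vectors chosen in each factor form a bounded family, whose class is
almost norming in the ultraproduct. -/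
theorem le_opMatNorm (hΦ : IsUltraproductMap q q' Φ) (hq : IsUltraproduct U q)
    (hq' : IsUltraproduct U q') {n : ℕ}
    (T : Matrix (Fin n) (Fin n) (lp (fun j => H j →L[ℂ] K j) ⊤)) {c : ℝ}
    (h : ∀ᶠ j in U, c < opMatNorm (T.map fun t => t j)) : c ≤ opMatNorm (T.map Φ) := by
  classical
  rcases lt_or_ge c 0 with hc | hc
  · exact hc.le.trans (opMatNorm_nonneg _)
  -- Where the hypothesis fails, the zero vector serves; those indices do not matter along `U`.
  have hv : ∀ j, ∃ v : Fin n → H j, ∑ b, ‖v b‖ ^ 2 ≤ 1 ∧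
      (c < opMatNorm (T.map fun t => t j) → c ^ 2 ≤ ∑ a, ‖∑ b, T a b j (v b)‖ ^ 2) := by
    intro j
    by_cases hj : c < opMatNorm (T.map fun t => t j)
    · obtain ⟨v, hv, hv'⟩ := exists_lt_sum_sq_norm _ hc hj
      exact ⟨v, hv, fun _ => hv'⟩
    · exact ⟨0, by simp, fun h => absurd h hj⟩
  choose v hv1 hv2 using hv
  have hv3 : ∀ b j, ‖v j b‖ ≤ 1 := fun b j => by
    refine le_of_sq_le_sq ?_ zero_le_one
    rw [one_pow]
    exact (Finset.single_le_sum (f := fun b => ‖v j b‖ ^ 2) (fun _ _ => sq_nonneg _)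
      (Finset.mem_univ b)).trans (hv1 j)
  let w : Fin n → lp H ⊤ := fun b => lpMk (fun j => v j b) 1 (hv3 b)
  have h1 : c ^ 2 ≤ ∑ a, ‖∑ b, T.map Φ a b (q (w b))‖ ^ 2 :=
    ge_of_tendsto (hΦ.tendsto_sum_sq_norm hq' T w) (h.mono fun j hj => hv2 j hj)
  have h2 : ∑ b, ‖q (w b)‖ ^ 2 ≤ 1 :=
    le_of_tendsto' (tendsto_finsetSum _ fun b _ => (hq.tendsto (w b)).pow 2) hv1
  refine le_of_sq_le_sq ?_ (opMatNorm_nonneg _)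
  refine h1.trans ((sum_sq_norm_le (T.map Φ) le_rfl _).trans ?_)
  exact mul_le_of_le_one_right (sq_nonneg _) h2

end IsUltraproductMap

end Ultraproduct

/-! ### Operator bimodules -/

section Representation

variable {J : Type u} [Preorder J] {U : Ultrafilter J}
  {H K : J → Type u} [∀ j, NormedAddCommGroup (H j)]
  [∀ j, InnerProductSpace ℂ (H j)] [∀ j, NormedAddCommGroup (K j)]
  [∀ j, InnerProductSpace ℂ (K j)]
  {L L' : Type u} [NormedAddCommGroup L] [InnerProductSpace ℂ L]
  [NormedAddCommGroup L'] [InnerProductSpace ℂ L']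
  {q : lp H ⊤ →ₗ[ℂ] L} {q' : lp K ⊤ →ₗ[ℂ] L'}

theorem IsCompleteIsometry.norm_le {S H K : Type u} [OperatorSpace S] [NormedAddCommGroup H]
    [InnerProductSpace ℂ H] [NormedAddCommGroup K] [InnerProductSpace ℂ K]
    {ι : S →ₗ[ℂ] (H →L[ℂ] K)} (h : IsCompleteIsometry ι) (x : S) : ‖ι x‖ ≤ ‖x‖ := by
  have h1 := norm_le_opMatNorm_one ((Matrix.of fun _ _ => x).map ι)
  rwa [h, OperatorSpace.matNorm_one] at h1

theorem IsCompletelyContractiveRep.norm_le {A H : Type u} [CStarAlgebra A] [NormedAddCommGroup H]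
    [InnerProductSpace ℂ H] {ρ : A →ₙₐ[ℂ] (H →L[ℂ] H)} (h : IsCompletelyContractiveRep ρ)
    (a : A) : ‖ρ a‖ ≤ ‖a‖ := by
  have h1 := norm_le_opMatNorm_one ((Matrix.of fun _ _ => a).map ρ)
  have h2 := h 1 (Matrix.of fun _ _ => a)
  rw [cstarMatNorm_one_by_one] at h2
  exact h1.trans h2

section Space

variable {F : Jᵒᵖ ⥤ OpSp.{u}}

/-- The family of operators given by completely isometric representations of the stages of a
projective system at an element of the limit. -/
def lpRepresentation (S : Cone F) (ι : ∀ j, F.obj (op j) →ₗ[ℂ] (H j →L[ℂ] K j))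
    (hι : ∀ j, IsCompleteIsometry (ι j)) : S.pt →ₗ[ℂ] lp (fun j => H j →L[ℂ] K j) ⊤ where
  toFun x := ⟨fun j => ι j (OpSp.leg S j x), memℓp_infty ⟨‖x‖, by
    rintro _ ⟨j, rfl⟩
    exact ((hι j).norm_le _).trans (OpSp.norm_leg_le S j x)⟩⟩
  map_add' x y := lp.ext (funext fun j => by simp only [map_add]; rfl)
  map_smul' c x := lp.ext (funext fun j => by simp only [map_smul]; rfl)

/-- Stage matrix norms increase with the index and have the limit norm as supremum. Any value below
it is therefore exceeded on a whole tail, and tails belong to `U`. -/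
theorem OpSp.IsProjectiveLimit.isCompleteIsometry_ultraproduct {S : Cone F}
    (hS : IsProjectiveLimit S) (hU : (U : Filter J) ≤ atTop) (hq : IsUltraproduct U q)
    (hq' : IsUltraproduct U q') {Φ : lp (fun j => H j →L[ℂ] K j) ⊤ →ₗ[ℂ] L →L[ℂ] L'}
    (hΦ : IsUltraproductMap q q' Φ) (ι : ∀ j, F.obj (op j) →ₗ[ℂ] (H j →L[ℂ] K j))
    (hι : ∀ j, IsCompleteIsometry (ι j)) :
    IsCompleteIsometry (Φ ∘ₗ lpRepresentation S ι hι) := by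
  intro n x
  have hj : ∀ j, opMatNorm ((x.map (lpRepresentation S ι hι)).map fun t => t j) =
      OperatorSpace.matNorm n (x.map (leg S j)) := fun j => hι j n (x.map (leg S j))
  refine le_antisymm ?_ (le_of_forall_lt fun c hc => ?_)
  · exact hΦ.opMatNorm_le hq hq' (x.map (lpRepresentation S ι hι)) <| univ_mem' fun j =>
      (hj j).trans_le (matNorm_leg_le S j x)
  · obtain ⟨d, hcd, hd⟩ := exists_between hc
    refine hcd.trans_le (hΦ.le_opMatNorm hq hq' (x.map (lpRepresentation S ι hι)) ?_)
    obtain ⟨i, hi⟩ : ∃ i, d < OperatorSpace.matNorm n (x.map (leg S i)) := by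
      by_contra! h
      exact hd.not_ge (hS.matNorm_le n x d h)
    filter_upwards [hU (eventually_ge_atTop i)] with j hij
    rw [hj]
    refine hi.trans_le (le_trans (le_of_eq (congrArg (OperatorSpace.matNorm n) ?_))
      ((F.map (homOfLE hij).op).contr n (x.map (leg S j))))
    ext a b
    exact (map_leg S hij (x a b)).symm

end Space

section Algebra

variable {G : J ⥤ UnitalCStarAlg.{u}} {A : Cocone G}

/-- Finitely many entries, each approximated at its own stage, can be moved to one common stage. -/
theorem UnitalCStarAlg.IsDirectedLimit.matrix_induction [IsDirectedOrder J] [Nonempty J]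
    (hA : IsDirectedLimit A) {n : ℕ} {P : Matrix (Fin n) (Fin n) A.pt → Prop} (hc : IsClosed {a | P a})
    (h : ∀ (i : J) (a : Matrix (Fin n) (Fin n) (G.obj i)), P (a.map (leg A i)))
    (a : Matrix (Fin n) (Fin n) A.pt) : P a := by
  have hd : DenseRange (Pi.map fun _ : Fin n => Pi.map fun _ : Fin n =>
      fun p : Σ j, G.obj j => leg A p.1 p.2) :=
    DenseRange.piMap fun _ => DenseRange.piMap fun _ => hA.dense
  refine hd.induction_on (p := P) a hc fun p => ?_
  obtain ⟨k, hk⟩ := (Set.finite_range fun pq : Fin n × Fin n => (p pq.1 pq.2).1).bddAbove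
  have hk' : ∀ r s, (p r s).1 ≤ k := fun r s => hk ⟨(r, s), rfl⟩
  refine (congrArg P ?_).mpr (h k (Matrix.of fun r s => (G.map (homOfLE (hk' r s))).hom (p r s).2))
  exact funext fun r => funext fun s => (leg_map A (hk' r s) _).symm

open Classical in
/-- The family of operators given by completely contractive representations of the stages of an
inductive system at an element of the `i`-th stage. -/
def lpRep (ρ : ∀ j, G.obj j →ₙₐ[ℂ] (K j →L[ℂ] K j))
    (hρ : ∀ j, IsCompletelyContractiveRep (ρ j)) (i : J) :
    G.obj i →ₗ[ℂ] lp (fun j => K j →L[ℂ] K j) ⊤ where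
  -- The value 0 elsewhere is invisible to an ultrafilter containing the tails.
  toFun a := ⟨fun j => if h : i ≤ j then ρ j ((G.map (homOfLE h)).hom a) else 0,
    memℓp_infty ⟨‖a‖, by
      rintro _ ⟨j, rfl⟩
      change ‖dite _ _ _‖ ≤ _
      split_ifs with h
      · exact ((hρ j).norm_le _).trans (UnitalCStarAlg.norm_hom_le _ _)
      · simp⟩⟩
  map_add' a b := lp.ext (funext fun j => by
    rw [lp.coeFn_add, Pi.add_apply]
    change dite _ _ _ = dite _ _ _ + dite _ _ _
    split_ifs <;> simp)
  map_smul' c a := lp.ext (funext fun j => by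
    rw [lp.coeFn_smul, Pi.smul_apply]
    change dite _ _ _ = _ • dite _ _ _
    split_ifs <;> simp)

theorem lpRep_apply {ρ : ∀ j, G.obj j →ₙₐ[ℂ] (K j →L[ℂ] K j)}
    {hρ : ∀ j, IsCompletelyContractiveRep (ρ j)} {i j : J} (a : G.obj i) (h : i ≤ j) :
    lpRep ρ hρ i a j = ρ j ((G.map (homOfLE h)).hom a) := dif_pos h

open Classical in
theorem norm_lpRep_le {ρ : ∀ j, G.obj j →ₙₐ[ℂ] (K j →L[ℂ] K j)}
    {hρ : ∀ j, IsCompletelyContractiveRep (ρ j)} {i : J} (a : G.obj i) :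
    ‖lpRep ρ hρ i a‖ ≤ ‖a‖ := by
  refine lp.norm_le_of_forall_le (norm_nonneg a) fun j => ?_
  change ‖dite _ _ _‖ ≤ _
  split_ifs with h
  · exact ((hρ j).norm_le _).trans (UnitalCStarAlg.norm_hom_le _ _)
  · simp

/-- Completely contractive representations of the stages of an inductive system of C⋆-algebras
induce a completely contractive representation of the limit on the ultraproduct. -/
theorem UnitalCStarAlg.IsDirectedLimit.exists_rep [IsDirectedOrder J] [Nonempty J]
    (hA : IsDirectedLimit A) [CompleteSpace L'] (hU : (U : Filter J) ≤ atTop) (hq' : IsUltraproduct U q')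
    {Φ : lp (fun j => K j →L[ℂ] K j) ⊤ →ₗ[ℂ] L' →L[ℂ] L'}
    (hΦ : IsUltraproductMap q' q' Φ) (hΦn : ∀ T, ‖Φ T‖ ≤ ‖T‖)
    (ρ : ∀ j, G.obj j →ₙₐ[ℂ] (K j →L[ℂ] K j)) (hρ : ∀ j, IsCompletelyContractiveRep (ρ j)) :
    ∃ r : A.pt →ₙₐ[ℂ] (L' →L[ℂ] L'), IsCompletelyContractiveRep r ∧
      ∀ i (a : G.obj i), r (leg A i a) = Φ (lpRep ρ hρ i a) := by
  have hev : ∀ i : J, ∀ᶠ j in (U : Filter J), i ≤ j := fun i => hU (eventually_ge_atTop i)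
  obtain ⟨g, hg, hgn⟩ := hA.exists_extend (fun i => Φ ∘ₗ lpRep ρ hρ i)
    (fun i j h a => hΦ.map_congr hq' hq' <| (hev j).mono fun k hk => by
      rw [lpRep_apply _ hk, lpRep_apply _ (h.trans hk), map_map])
    zero_le_one (fun i a => by
      rw [one_mul]
      exact (hΦn _).trans (norm_lpRep_le a))
  have hmul : ∀ a b, g (a * b) = g a * g b := by
    intro a b
    induction a using hA.induction with
    | hc => exact isClosed_eq (by fun_prop) (by fun_prop)
    | h i a =>
    induction b using hA.induction with
    | hc => exact isClosed_eq (by fun_prop) (by fun_prop)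
    | h j b =>
    obtain ⟨k, hik, hjk⟩ := exists_ge_ge i j
    rw [← leg_map A hik, ← leg_map A hjk, ← map_mul, hg, hg, hg]
    refine hΦ.map_comp hΦ hΦ hq' hq' ((hev k).mono fun l hl => ?_)
    rw [lpRep_apply _ hl, lpRep_apply _ hl, lpRep_apply _ hl, map_mul, map_mul]
    rfl
  refine ⟨{ toFun := g, map_smul' := map_smul g, map_zero' := map_zero g, map_add' := map_add g,
            map_mul' := hmul }, fun n a => ?_, hg⟩
  change opMatNorm (a.map g) ≤ _
  induction a using hA.matrix_induction with
  | hc =>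
    -- Tested on fixed vectors, the bound becomes a family of inequalities between continuous
    -- functions of the matrix.
    simp only [opMatNorm_le_iff _ (cstarMatNorm_nonneg _), Set.ofPred_forall]
    refine isClosed_iInter fun v => isClosed_le ?_ ?_
    · simp only [Matrix.map_apply]
      fun_prop
    · exact (continuous_cstarMatNorm.pow 2).mul continuous_const
  | h i a =>
    refine le_of_forall_gt_imp_ge_of_dense fun c hc => ?_
    -- From stage `k` on the matrix has norm below `c`, so the representations, being completely
    -- contractive, keep it at most `c` on a set of `U`.
    obtain ⟨k, hik, hk⟩ := hA.exists_cstarMatNorm_lt a hc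
    have h1 : (a.map (leg A i)).map g = (a.map (lpRep ρ hρ i)).map Φ := by
      ext1 r s
      exact hg i (a r s)
    rw [h1]
    refine hΦ.opMatNorm_le hq' hq' _ ((hev k).mono fun j hj => ?_)
    have h2 : ((a.map (lpRep ρ hρ i)).map fun t => t j) =
        ((a.map (G.map (homOfLE hik)).hom).map (G.map (homOfLE hj)).hom).map (ρ j) := by
      ext1 r s
      simp only [Matrix.map_apply]
      rw [lpRep_apply _ (hik.trans hj), map_map]
    rw [h2]
    exact (hρ j n _).trans ((cstarMatNorm_map_le _ _).trans hk.le)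

end Algebra

end Representation

namespace CStarGraph

open UnitalCStarAlg OpSp

variable {J : Type u} [Preorder J] [IsDirectedOrder J] [Nonempty J] {F : Jᵒᵖ ⥤ CStarGraph.{u}}
  {A : Cocone (algSystem F)} {S : Cone (spaceSystem F)}

/-- The ultraproducts of the stage representations implement the action: the intertwining relation
holds on a tail for stage elements and extends by continuity. The left and right halves use separate
ultraproducts. -/
theorem isOperatorBimodule_limit (hA : IsDirectedLimit A) (hS : IsProjectiveLimit S)
    (b : ContractiveBimodule A.pt S.pt) (hb : IsCompatible F A S b)
    (h : ∀ j : J, (F.obj (op j)).bimod.IsOperatorBimodule) : b.IsOperatorBimodule := by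
  obtain ⟨hl, hr⟩ := (isCompatible_iff b).1 hb
  let U : Ultrafilter J := Ultrafilter.of atTop
  have hU : (U : Filter J) ≤ atTop := Ultrafilter.of_le atTop
  have hev : ∀ i : J, ∀ᶠ j in (U : Filter J), i ≤ j := fun i => hU (eventually_ge_atTop i)
  constructor
  · choose H K i1 i2 _ i4 i5 _ ι ρ hι hρ hact using fun j => (h j).1
    let ι' : ∀ j, (spaceSystem F).obj (op j) →ₗ[ℂ] (H j →L[ℂ] K j) := ι
    let ρ' : ∀ j, (algSystem F).obj j →ₙₐ[ℂ] (K j →L[ℂ] K j) := ρ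
    obtain ⟨L, _, _, _, q, hq⟩ := exists_isUltraproduct U H
    obtain ⟨L', _, _, _, q', hq'⟩ := exists_isUltraproduct U K
    obtain ⟨Φ, hΦ, hΦn⟩ := hq.exists_map hq'
    obtain ⟨Ψ, hΨ, hΨn⟩ := hq'.exists_map hq'
    obtain ⟨r, hr, hr'⟩ := hA.exists_rep hU hq' hΨ hΨn ρ' hρ
    have hi := hS.isCompleteIsometry_ultraproduct hU hq hq' hΦ ι' hι
    refine ⟨L, L', _, _, inferInstance, _, _, inferInstance, _, r, hi, hr, fun a x => ?_⟩
    have hc1 : Continuous (Φ ∘ₗ lpRepresentation S ι' hι) :=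
      AddMonoidHomClass.continuous_of_bound _ 1 fun x => by simpa using hi.norm_le x
    have hc2 : Continuous r :=
      AddMonoidHomClass.continuous_of_bound r 1 fun x => by simpa using hr.norm_le x
    induction a using hA.induction with
    | hc =>
      exact isClosed_eq (hc1.comp (b.continuous_left_apply x)) (hc2.clm_comp continuous_const)
    | h i a =>
      rw [hr']
      refine hΦ.map_comp hΨ hΦ hq hq' ((hev i).mono fun j hij => ?_)
      have h1 : OpSp.leg S j (b.left (UnitalCStarAlg.leg A i a) x) =
          leftAction F j (((algSystem F).map (homOfLE hij)).hom a) (OpSp.leg S j x) := by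
        rw [← leg_map A hij, hl]
      exact (congrArg (ι' j) h1).trans ((hact j _ _).trans
        (congrArg (fun f => f ∘L ι' j (OpSp.leg S j x)) (lpRep_apply a hij).symm))
  · choose H K i1 i2 _ i4 i5 _ ι ρ hι hρ hact using fun j => (h j).2
    let ι' : ∀ j, (spaceSystem F).obj (op j) →ₗ[ℂ] (H j →L[ℂ] K j) := ι
    let ρ' : ∀ j, (algSystem F).obj j →ₙₐ[ℂ] (H j →L[ℂ] H j) := ρ
    obtain ⟨L, _, _, _, q, hq⟩ := exists_isUltraproduct U H
    obtain ⟨L', _, _, _, q', hq'⟩ := exists_isUltraproduct U K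
    obtain ⟨Φ, hΦ, hΦn⟩ := hq.exists_map hq'
    obtain ⟨Ψ, hΨ, hΨn⟩ := hq.exists_map hq
    obtain ⟨r, hr₁, hr'⟩ := hA.exists_rep hU hq hΨ hΨn ρ' hρ
    have hi := hS.isCompleteIsometry_ultraproduct hU hq hq' hΦ ι' hι
    refine ⟨L, L', _, _, inferInstance, _, _, inferInstance, _, r, hi, hr₁, fun a x => ?_⟩
    have hc1 : Continuous (Φ ∘ₗ lpRepresentation S ι' hι) :=
      AddMonoidHomClass.continuous_of_bound _ 1 fun x => by simpa using hi.norm_le x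
    have hc2 : Continuous r :=
      AddMonoidHomClass.continuous_of_bound r 1 fun x => by simpa using hr₁.norm_le x
    induction a using hA.induction with
    | hc =>
      exact isClosed_eq (hc1.comp (b.continuous_right_apply x)) (continuous_const.clm_comp hc2)
    | h i a =>
      rw [hr']
      refine hΨ.map_comp hΦ hΦ hq hq' ((hev i).mono fun j hij => ?_)
      have h1 : OpSp.leg S j (b.right (MulOpposite.op (UnitalCStarAlg.leg A i a)) x) =
          rightAction F j (((algSystem F).map (homOfLE hij)).hom a) (OpSp.leg S j x) := by
        rw [← leg_map A hij, hr]
      exact (congrArg (ι' j) h1).trans ((hact j _ _).trans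
        (congrArg (fun f => ι' j (OpSp.leg S j x) ∘L f) (lpRep_apply a hij).symm))

end CStarGraph

/-! ### The universal property in C⋆-graphs -/

namespace CStarGraph

open UnitalCStarAlg OpSp

variable {J : Type u} [Preorder J] {F : Jᵒᵖ ⥤ CStarGraph.{u}}

/-- The cocone of algebras of a cone of C⋆-graphs. -/
def algCocone (s : Cone F) : Cocone (algSystem F) where
  pt := s.pt.alg
  ι :=
    { app := fun j => (s.π.app (op j)).π
      naturality := fun _ _ f => congrArg CStarGraph.Hom.π (s.w f.op) }

/-- The cone of spaces of a cone of C⋆-graphs. -/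
def spaceCone (s : Cone F) : Cone (spaceSystem F) where
  pt := s.pt.space
  π :=
    { app := fun j => (s.π.app j).e
      naturality := fun _ _ f => (congrArg CStarGraph.Hom.e (s.w f)).symm }

variable {A : Cocone (algSystem F)} {S : Cone (spaceSystem F)}

theorem leg_left_leg {b : ContractiveBimodule A.pt S.pt} (hb : IsCompatible F A S b) {i j k : J}
    (hik : i ≤ k) (hjk : j ≤ k) (a : (algSystem F).obj i) (x : S.pt) :
    OpSp.leg S j (b.left (UnitalCStarAlg.leg A i a) x) =
      ((spaceSystem F).map (homOfLE hjk).op).lin (leftAction F k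
        (((algSystem F).map (homOfLE hik)).hom a) (OpSp.leg S k x)) := by
  rw [← ((isCompatible_iff b).1 hb).1, leg_map, map_leg]

theorem leg_right_leg {b : ContractiveBimodule A.pt S.pt} (hb : IsCompatible F A S b) {i j k : J}
    (hik : i ≤ k) (hjk : j ≤ k) (a : (algSystem F).obj i) (x : S.pt) :
    OpSp.leg S j (b.right (MulOpposite.op (UnitalCStarAlg.leg A i a)) x) =
      ((spaceSystem F).map (homOfLE hjk).op).lin (rightAction F k
        (((algSystem F).map (homOfLE hik)).hom a) (OpSp.leg S k x)) := by
  rw [← ((isCompatible_iff b).1 hb).2, leg_map, map_leg]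

variable [IsDirectedOrder J] [Nonempty J]

/-- The mediating maps of the two limits form the only candidate pair. What needs proof is its
equivariance, checked for stage elements after applying the legs and extended by density. -/
theorem nonempty_isLimit_pairCone (hA : IsColimit A) (hS : IsLimit S)
    (b : ContractiveBimodule A.pt S.pt) (hb : IsCompatible F A S b) :
    Nonempty (IsLimit (pairCone F A S b hb)) := by
  have hA' := isDirectedLimit_of_isColimit hA
  have hS' := isProjectiveLimit_of_isLimit hS
  obtain ⟨hl, hr⟩ := (isCompatible_iff b).1 hb
  have hcont : ∀ {B C : UnitalCStarAlg.{u}} (f : B ⟶ C), Continuous f.hom := fun f =>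
    AddMonoidHomClass.continuous_of_bound f.hom 1 fun a => by
      simpa using UnitalCStarAlg.norm_hom_le f a
  have hcont' : ∀ {X Y : OpSp.{u}} (f : X ⟶ Y), Continuous f.lin := fun f =>
    AddMonoidHomClass.continuous_of_bound f.lin 1 fun a => by
      simpa using OpSp.norm_hom_le f a
  have hπ : ∀ (s : Cone F) (j : J) (a : (algSystem F).obj j),
      (hA.desc (algCocone s)).hom (UnitalCStarAlg.leg A j a) = (s.π.app (op j)).π.hom a :=
    fun s j a => congrArg (fun f => UnitalCStarAlg.Hom.hom f a) (hA.fac (algCocone s) j)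
  have he : ∀ (s : Cone F) (j : J) (x : s.pt.space),
      OpSp.leg S j ((hS.lift (spaceCone s)).lin x) = (s.π.app (op j)).e.lin x :=
    fun s j x => congrArg (fun f => OpSp.Hom.lin f x) (hS.fac (spaceCone s) (op j))
  have hleft : ∀ (s : Cone F) (a : A.pt) (x : s.pt.space),
      b.left a ((hS.lift (spaceCone s)).lin x) = (hS.lift (spaceCone s)).lin
        (s.pt.bimod.left ((hA.desc (algCocone s)).hom a) x) := by
    intro s a x
    induction a using hA'.induction with
    | hc =>
      exact isClosed_eq (b.continuous_left_apply _) ((hcont' _).comp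
        ((s.pt.bimod.continuous_left_apply x).comp (hcont (hA.desc (algCocone s)))))
    | h i a =>
    refine hS'.ext_of_ge i fun k hk => ?_
    rw [← leg_map A hk, hl, he, he, hπ]
    exact ((s.π.app (op k)).left_eq _ x).symm
  have hright : ∀ (s : Cone F) (a : A.pt) (x : s.pt.space),
      b.right (MulOpposite.op a) ((hS.lift (spaceCone s)).lin x) = (hS.lift (spaceCone s)).lin
        (s.pt.bimod.right (MulOpposite.op ((hA.desc (algCocone s)).hom a)) x) := by
    intro s a x
    induction a using hA'.induction with
    | hc =>
      exact isClosed_eq (b.continuous_right_apply _) ((hcont' _).comp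
        ((s.pt.bimod.continuous_right_apply x).comp (hcont (hA.desc (algCocone s)))))
    | h i a =>
    refine hS'.ext_of_ge i fun k hk => ?_
    rw [← leg_map A hk, hr, he, he, hπ]
    exact ((s.π.app (op k)).right_eq _ x).symm
  refine ⟨{ lift := fun s => ⟨hA.desc (algCocone s), hS.lift (spaceCone s), fun a c x => ?_⟩
            fac := fun s j => ?_
            uniq := fun s m hm => ?_ }⟩
  · exact (congrArg (b.left a) (hright s c x)).trans (hleft s a _)
  · exact CStarGraph.Hom.ext (hA.fac (algCocone s) j.unop) (hS.fac (spaceCone s) j)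
  · refine CStarGraph.Hom.ext ?_ ?_
    · exact hA.uniq (algCocone s) m.π fun j => congrArg CStarGraph.Hom.π (hm (op j))
    · exact hS.uniq (spaceCone s) m.e fun j => congrArg CStarGraph.Hom.e (hm j)

end CStarGraph

end

theorem mainTheorem4 {J : Type u} [Preorder J] [IsDirectedOrder J] [Nonempty J]
    (F : Jᵒᵖ ⥤ CStarGraph.{u}) :
    HasColimit (CStarGraph.algSystem F) ∧ HasLimit (CStarGraph.spaceSystem F) ∧
    ∀ (A : Cocone (CStarGraph.algSystem F)) (S : Cone (CStarGraph.spaceSystem F)),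
      IsColimit A → IsLimit S →
      (∃! b : ContractiveBimodule A.pt S.pt, CStarGraph.IsCompatible F A S b) ∧
      ∀ (b : ContractiveBimodule A.pt S.pt) (h : CStarGraph.IsCompatible F A S b),
        Nonempty (IsLimit (CStarGraph.pairCone F A S b h)) ∧
        (∀ (i j k : J) (hik : i ≤ k) (hjk : j ≤ k) (a : (F.obj (op i)).alg) (x : S.pt),
          (S.π.app (op j)).lin (b.left ((A.ι.app i).hom a) x) =
            (F.map (homOfLE hjk).op).e.lin ((F.obj (op k)).bimod.left
              ((F.map (homOfLE hik).op).π.hom a) ((S.π.app (op k)).lin x)) ∧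
          (S.π.app (op j)).lin (b.right (MulOpposite.op ((A.ι.app i).hom a)) x) =
            (F.map (homOfLE hjk).op).e.lin ((F.obj (op k)).bimod.right
              (MulOpposite.op ((F.map (homOfLE hik).op).π.hom a)) ((S.π.app (op k)).lin x))) ∧
        ((∀ j : J, (F.obj (op j)).bimod.IsOperatorBimodule) → b.IsOperatorBimodule) := by
  obtain ⟨A₀, hA₀⟩ := UnitalCStarAlg.exists_isDirectedLimit (CStarGraph.algSystem F)
  obtain ⟨S₀, hS₀⟩ := OpSp.exists_isProjectiveLimit (CStarGraph.spaceSystem F)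
  obtain ⟨hA₀'⟩ := hA₀.isColimit
  obtain ⟨hS₀'⟩ := hS₀.isLimit
  refine ⟨⟨⟨⟨A₀, hA₀'⟩⟩⟩, ⟨⟨⟨S₀, hS₀'⟩⟩⟩, fun A S hA hS => ?_⟩
  have hA' := UnitalCStarAlg.isDirectedLimit_of_isColimit hA
  have hS' := OpSp.isProjectiveLimit_of_isLimit hS
  refine ⟨CStarGraph.existsUnique_isCompatible hA' hS', fun b hb =>
    ⟨CStarGraph.nonempty_isLimit_pairCone hA hS b hb, fun i j k hik hjk a x =>
      ⟨CStarGraph.leg_left_leg hb hik hjk a x, CStarGraph.leg_right_leg hb hik hjk a x⟩,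
    CStarGraph.isOperatorBimodule_limit hA' hS' b hb⟩⟩
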